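/- Write $\mathcal F f(k)=\frac1{2\pi}\int_{\mathbb R^2}f(x)e^{-ik\cdot x}\,dx$ for $f\in L^1(\mathbb R^2)$, and keep the same letter for its unitary extension to $L^2(\mathbb R^2)$. Let $$\mathcal C=\Big\{f\in L^1(\mathbb R^2;\mathbb C):\ k\mapsto \frac{\mathcal F f(k)}{|k|}\in L^2(\mathbb R^2)\Big\},\qquad \mathcal D(f,h)=4\pi\int_{\mathbb R^2}\frac{\overline{\mathcal F f(k)}\,\mathcal F h(k)}{|k|^2}\,dk\quad(f,h\in\mathcal C).$$ For $f\in\mathcal C$ put $W_f=\mathcal F^{-1}\big(k\mapsto \mathcal F f(k)/|k|\big)=(-\Delta)^{-1/2}f\in L^2(\mathbb R^2)$ and $V_f=4\pi\big(\mathcal I_1^{W_f}+\mathcal I_2^{W_f}\big)$, where, for $g\in L^2(\mathbb R^2)$, $$\mathcal I_1^{g}(x)=\frac1{2\pi}\int_{|y|<1}\frac{g(y)}{|x-y|}\,dy,\qquad \mathcal I_2^{g}(x)=\frac1{2\pi}\int_{|y|\ge1}\Big(\frac1{|x-y|}-\frac1{|y|}\Big)g(y)\,dy .$$ **Theorem.**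 Let $f\in\mathcal C$ be real-valued. Then the integrals defining $V_f(x)$ converge absolutely for almost every $x$, $V_f\in L^1_{\rm loc}(\mathbb R^2)$, and the following hold. 1. For every $h\in\mathcal C$, $$\mathcal D(f,h)=\int_{\mathbb R^2}V_f(x)\,h(x)\,dx .$$ Here the integral is the Lebesgue integral whenever $V_fh\in L^1(\mathbb R^2)$, which is the case for instance for every Schwartz function $h$; for general $h\in\mathcal C$ the product $V_fh$ need not be integrable, and the integral is the improper integral $\lim_{M\to\infty}\int_{\mathbb R^2}T_M(V_f)\,h\,dx$ (which exists, and agrees with the Lebesgue integral when $V_fh\in L^1$), where $T_M(z)=z$ for $|z|\le M$ and $T_M(z)=Mz/|z|$ for $|z|>M$. 2. $-\Delta V_f=4\pi f$ in the sense of distributions on $\mathbb R^2$, that is, $\int V_f\,(-\Delta\varphi)\,dx=4\pi\int f\varphi\,dx$ for every $\varphi\in C_c^\infty(\mathbb R^2)$. -/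

import Mathlib

open MeasureTheory Filter Topology
open scoped FourierTransform ContDiff SchwartzMap

noncomputable section

/-- The plane `ℝ²` with its Euclidean norm and Lebesgue measure. -/
abbrev Plane : Type := EuclideanSpace ℝ (Fin 2)

/-- The unitary Fourier transform `(2π)⁻¹ ∫ f(x) e^{-i k·x} dx` of an integrable function on the
plane. -/
def planeFourier (f : Plane → ℂ) (k : Plane) : ℂ :=
  (1 / (2 * Real.pi) : ℂ) * ∫ x : Plane, f x * Complex.exp (-Complex.I * (inner ℝ k x : ℝ))

/-- The Fourier transform of `f` divided by `|k|` (the value at the single point `k = 0` is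
irrelevant). -/
def fourierDivNorm (f : Plane → ℂ) (k : Plane) : ℂ :=
  planeFourier f k / (‖k‖ : ℂ)

/-- The Coulomb space: integrable functions `f` on the plane for which `k ↦ (ℱf)(k) / |k|` is
square integrable. -/
def coulombSpace : Set (Plane → ℂ) :=
  {f | Integrable f ∧ MemLp (fourierDivNorm f) 2}

/-- The Hartree interaction `𝒟(f, g) = 4π ∫ conj((ℱf)(k)) (ℱg)(k) / |k|² dk`. -/
def hartree (f g : Plane → ℂ) : ℂ :=
  4 * (Real.pi : ℂ) *
    ∫ k : Plane, (starRingEnd ℂ) (planeFourier f k) * planeFourier g k / ((‖k‖ : ℂ) ^ 2)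

theorem MeasureTheory.MemLp.planeDilate {g : Plane → ℂ} (hg : MemLp g 2) :
    MemLp (fun ξ : Plane => (2 * Real.pi : ℂ) * g ((2 * Real.pi) • ξ)) 2 := by
  refine MemLp.const_mul ?_ _
  have hr : (2 * Real.pi : ℝ) ≠ 0 := by positivity
  refine MemLp.comp_of_map (f := fun ξ : Plane => (2 * Real.pi) • ξ) (g := g) ?_
    (measurable_const_smul _).aemeasurable
  rw [Measure.map_addHaar_smul _ hr]
  exact hg.smul_measure ENNReal.ofReal_ne_top

open Classical in
/-- The inverse, on `L²`, of the unitary Fourier transform `planeFourier`, i.e. the `L²` extension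
of `g ↦ (2π)⁻¹ ∫ g(k) e^{i k·x} dk` (and `0` if `g` is not in `L²`). It is obtained from Mathlib's
inverse Fourier transform on `L²`, whose kernel is `e^{2π i ξ·x}`, by the change of variables
`k = 2π ξ`. -/
def planeFourierInvL2 (g : Plane → ℂ) : Lp ℂ 2 (volume : Measure Plane) :=
  if hg : MemLp g 2 then 𝓕⁻ (hg.planeDilate.toLp _) else 0

/-- `W_f = (-Δ)^{-1/2} f`, the inverse Fourier transform in `L²` of `k ↦ (ℱf)(k) / |k|`. -/
def coulombW (f : Plane → ℂ) : Lp ℂ 2 (volume : Measure Plane) :=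
  planeFourierInvL2 (fourierDivNorm f)

/-- The integrand, at the point `x`, of the inner modified Riesz potential. -/
def rieszInnerKernel (g : Plane → ℂ) (x y : Plane) : ℂ :=
  ((1 / ‖x - y‖ : ℝ) : ℂ) * g y

/-- The integrand, at the point `x`, of the outer modified Riesz potential. -/
def rieszOuterKernel (g : Plane → ℂ) (x y : Plane) : ℂ :=
  ((1 / ‖x - y‖ - 1 / ‖y‖ : ℝ) : ℂ) * g y

/-- `ℐ₁^g(x) = (2π)⁻¹ ∫_{|y| < 1} g(y) / |x - y| dy`. -/
def rieszInner (g : Plane → ℂ) (x : Plane) : ℂ :=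
  (1 / (2 * Real.pi) : ℂ) * ∫ y in {y : Plane | ‖y‖ < 1}, rieszInnerKernel g x y

/-- `ℐ₂^g(x) = (2π)⁻¹ ∫_{|y| ≥ 1} (1 / |x - y| - 1 / |y|) g(y) dy`. -/
def rieszOuter (g : Plane → ℂ) (x : Plane) : ℂ :=
  (1 / (2 * Real.pi) : ℂ) * ∫ y in {y : Plane | 1 ≤ ‖y‖}, rieszOuterKernel g x y

/-- The mean-field potential `V_f = 4π (ℐ₁^{W_f} + ℐ₂^{W_f})`. -/
def meanFieldPotential (f : Plane → ℂ) (x : Plane) : ℂ :=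
  4 * (Real.pi : ℂ) * (rieszInner (coulombW f) x + rieszOuter (coulombW f) x)

/-- Radial truncation at height `M > 0`: `z` if `|z| ≤ M`, and `M z / |z|` otherwise. For real `z`
this is `max (-M) (min z M)`. -/
def truncateAt (M : ℝ) (z : ℂ) : ℂ :=
  ((M / max M ‖z‖ : ℝ) : ℂ) * z

/-- The improper integral `∫ V h`, computed by truncating the (possibly unbounded) factor `V`,
exists and equals `L`: the truncated integrals `∫ T_M(V) h`, which converge absolutely for
integrable `h`, tend to `L` as `M → ∞`. If `V h` is integrable, `L` is its Lebesgue integral. -/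
def HasTruncatedIntegral (V h : Plane → ℂ) (L : ℂ) : Prop :=
  Tendsto (fun M : ℝ => ∫ x : Plane, truncateAt M (V x) * h x) atTop (𝓝 L)

/-- `-Δ V = u` in the sense of distributions on the plane, for locally integrable `V` and `u`. -/
def IsDistribNegLaplacian (V u : Plane → ℂ) : Prop :=
  LocallyIntegrable V ∧ LocallyIntegrable u ∧
    ∀ φ : Plane → ℂ, ContDiff ℝ ∞ φ → HasCompactSupport φ →
      ∫ x : Plane, V x * (-(Laplacian.laplacian φ x)) = ∫ x : Plane, u x * φ x

end

/-! With `K = rieszSymbol f`, the function `W_f` is the `L²` inverse transform of `K`, and the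
Hartree form is `4π` times the `L²` inner product of symbols. The potential `V_f` is formally `4π
(-Δ)⁻¹ f`, known up to a constant.

For a Schwartz function `s` of finite Coulomb energy the identity is a computation. Finite energy
forces `∫ s = 0` (`integral_eq_zero_of_memLp_rieszSymbol`), so after Fubini the correction `1/|y|`
in the kernel disappears. What remains is `1/|x|` convolved with `s`, which is `2π 𝓕⁻ (rieszSymbol
s)` because `1/|x|` is its own Fourier transform in the plane. Parseval then gives
`integral_meanFieldPotential_mul_schwartz`. Taking `s = -Δφ`, which always has finite energy, yields
the distributional equation.

A general `h` is reached by density of Schwartz symbols in `L²`. Since `V_f` may be unbounded and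
`h` is merely `L¹`, the limit needs a bound on `∫ T_M(V_f) h` by the Coulomb norm of `h`, uniformly
in `M`. Testing the Schwartz identity against differences `s - s(· + c)` shows that `V_f - V_f(· -
c)` has `L²` norm at most `4π ‖W_f‖ |c|`, and the Lipschitz map `T_M` preserves this up to a factor
2. The analytic core is `norm_integral_mul_le_of_difference`: a bounded `u` with such differences
pairs with `h` with a constant that ignores `sup |u|`. It is proved without derivatives: the
difference of `h` averaged at two Gaussian widths is `v` minus its own Gaussian average, where `v`
is a finite sum of averages of `h`. The Gaussian Dirichlet form bounds the pairing with `u`; then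
one width goes to infinity, where `∫ h = 0` kills the term, and the other to zero. -/

/-! ### Symbols in the normalisation with kernel `e^{-2πi ξ·x}` -/

/-- The symbol of `(-Δ)^{-1/2} f`, for the Fourier transform with kernel `e^{-2πi ξ·x}`. -/
noncomputable def rieszSymbol (f : Plane → ℂ) (ξ : Plane) : ℂ :=
  𝓕 f ξ / ((2 * Real.pi * ‖ξ‖ : ℝ) : ℂ)

theorem planeFourier_smul (f : Plane → ℂ) (ξ : Plane) :
    planeFourier f ((2 * Real.pi) • ξ) = (1 / (2 * Real.pi) : ℂ) * 𝓕 f ξ := by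
  rw [planeFourier, Real.fourier_eq']
  congr 1
  refine integral_congr_ae (Eventually.of_forall fun x => ?_)
  simp only [smul_eq_mul]
  rw [mul_comm, real_inner_comm, inner_smul_right]
  congr 2
  push_cast
  ring

theorem fourierDivNorm_smul (f : Plane → ℂ) (ξ : Plane) :
    (2 * Real.pi : ℂ) * fourierDivNorm f ((2 * Real.pi) • ξ) = rieszSymbol f ξ := by
  have hpi : (Real.pi : ℂ) ≠ 0 := by exact_mod_cast Real.pi_ne_zero
  rw [fourierDivNorm, planeFourier_smul, rieszSymbol, norm_smul, Real.norm_eq_abs,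
    abs_of_pos (by positivity)]
  push_cast
  by_cases h : (‖ξ‖ : ℂ) = 0
  · simp [h]
  · field_simp

theorem memLp_rieszSymbol {f : Plane → ℂ} (hf : f ∈ coulombSpace) : MemLp (rieszSymbol f) 2 := by
  have := hf.2.planeDilate
  simpa only [fourierDivNorm_smul] using this

theorem coulombW_eq {f : Plane → ℂ} (hf : f ∈ coulombSpace) :
    coulombW f = 𝓕⁻ ((memLp_rieszSymbol hf).toLp _) := by
  rw [coulombW, planeFourierInvL2, dif_pos hf.2]
  congr 1
  apply MemLp.toLp_congr
  exact Eventually.of_forall fun ξ => fourierDivNorm_smul f ξ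

/-- The substitution `k = 2πξ` has Jacobian `(2π)²`, which is exactly absorbed by the two unitary
prefactors `1/(2π)`. The remaining `|k|²` is split evenly between the two symbols. -/
theorem hartree_eq (f h : Plane → ℂ) :
    hartree f h = 4 * (Real.pi : ℂ) *
      ∫ ξ, (starRingEnd ℂ) (rieszSymbol f ξ) * rieszSymbol h ξ := by
  have hpi : (Real.pi : ℂ) ≠ 0 := by exact_mod_cast Real.pi_ne_zero
  rw [hartree]
  congr 1
  have := Measure.integral_comp_smul (volume : Measure Plane)
    (fun k : Plane => (starRingEnd ℂ) (planeFourier f k) * planeFourier h k / ((‖k‖ : ℂ) ^ 2))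
    (2 * Real.pi)
  simp only [finrank_euclideanSpace, Fintype.card_fin] at this
  rw [abs_of_pos (by positivity), Complex.real_smul, Complex.ofReal_inv] at this
  rw [eq_inv_mul_iff_mul_eq₀ (by norm_cast; positivity)] at this
  rw [← this, ← integral_const_mul]
  refine integral_congr_ae (Eventually.of_forall fun ξ => ?_)
  simp only [rieszSymbol, planeFourier_smul, norm_smul, Real.norm_eq_abs]
  rw [abs_of_pos (by positivity)]
  simp only [map_mul, map_div₀, Complex.conj_ofReal, map_one, map_ofNat]
  push_cast
  by_cases h : (‖ξ‖ : ℂ) = 0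
  · simp [h]
  · field_simp

theorem fourier_neg_of_real {f : Plane → ℂ} (hf : ∀ᵐ x, (f x).im = 0) (ξ : Plane) :
    𝓕 f (-ξ) = (starRingEnd ℂ) (𝓕 f ξ) := by
  rw [Real.fourier_eq', Real.fourier_eq', ← integral_conj]
  refine integral_congr_ae ?_
  filter_upwards [hf] with x hx
  simp only [smul_eq_mul, map_mul, ← Complex.exp_conj, Complex.conj_I, Complex.conj_ofReal,
    Complex.conj_eq_iff_im.2 hx, inner_neg_right]
  congr 2
  push_cast
  ring

/-- Reality of `f` enters the whole argument only through this symmetry. It turns the bilinear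
pairings produced by Parseval into the sesquilinear form `𝒟`. -/
theorem rieszSymbol_neg_of_real {f : Plane → ℂ} (hf : ∀ᵐ x, (f x).im = 0) (ξ : Plane) :
    rieszSymbol f (-ξ) = (starRingEnd ℂ) (rieszSymbol f ξ) := by
  have h2 : (starRingEnd ℂ) 2 = 2 := map_ofNat _ 2
  simp [rieszSymbol, fourier_neg_of_real hf, h2]

/-! ### Inverse Fourier transform on `L²` and Parseval -/

/-- Exchange of the inverse Fourier transform between integrable functions. -/
theorem integral_fourierInv_mul_swap {K s : Plane → ℂ} (hK : Integrable K) (hs : Integrable s) :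
    ∫ x, 𝓕⁻ K x * s x = ∫ ξ, K ξ * 𝓕⁻ s ξ := by
  have h := VectorFourier.integral_fourierIntegral_smul_eq_flip (μ := (volume : Measure Plane))
    (ν := (volume : Measure Plane)) (L := -innerₗ Plane) (e := Real.fourierChar)
    Real.continuous_fourierChar (continuous_inner (𝕜 := ℝ) (E := Plane)).neg hK hs
  simp only [smul_eq_mul] at h
  have hflip : (-innerₗ Plane).flip = -innerₗ Plane := by
    ext x y
    simp [real_inner_comm]
  rw [hflip] at h
  exact h

/-- The inverse Fourier transform on `L²`, tested against a Schwartz function. -/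
theorem integral_fourierInv_Lp_mul (G : Lp ℂ 2 (volume : Measure Plane)) (s : 𝓢(Plane, ℂ)) :
    ∫ x, (𝓕⁻ G : Lp ℂ 2 (volume : Measure Plane)) x * s x = ∫ ξ, G ξ * 𝓕⁻ (s : Plane → ℂ) ξ := by
  have h := congrArg (fun T => T s) (Lp.fourierInv_toTemperedDistribution_eq G)
  simp only [TemperedDistribution.fourierInv_apply, Lp.toTemperedDistribution_apply,
    smul_eq_mul, mul_comm] at h
  rw [← h, ← SchwartzMap.fourierInv_coe]

/-- The `L²` transform is an abstract extension, so it is compared with the integral formula by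
testing both against smooth compactly supported functions and moving the transform onto the test
function. -/
theorem fourierInv_toLp_ae {K : Plane → ℂ} (hK : Integrable K) (hK2 : MemLp K 2) :
    (𝓕⁻ (hK2.toLp K) : Lp ℂ 2 (volume : Measure Plane)) =ᵐ[volume] 𝓕⁻ K := by
  have hcont : Continuous (𝓕⁻ K) := by
    rw [Real.fourierInv_eq_fourier_comp_neg]
    exact VectorFourier.fourierIntegral_continuous Real.continuous_fourierChar
      (by simpa using continuous_inner (𝕜 := ℝ) (E := Plane)) hK.comp_neg
  refine ae_eq_of_integral_contDiff_smul_eq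
    ((Lp.memLp _).locallyIntegrable (by norm_num)) hcont.locallyIntegrable ?_
  intro g hg hgc
  have hgc' : HasCompactSupport (fun x => (g x : ℂ)) :=
    hgc.comp_left (g := fun r : ℝ => (r : ℂ)) (by simp)
  set s : 𝓢(Plane, ℂ) := hgc'.toSchwartzMap (Complex.ofRealCLM.contDiff.comp hg)
  have hs : ∀ x, s x = g x := fun x => rfl
  simp only [Complex.real_smul, ← hs, mul_comm (s _)]
  rw [integral_fourierInv_Lp_mul, integral_fourierInv_mul_swap hK s.integrable]
  refine integral_congr_ae ?_
  filter_upwards [hK2.coeFn_toLp] with x hx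
  rw [hx]

theorem Lp.norm_fourierInv_eq (G : Lp ℂ 2 (volume : Measure Plane)) : ‖𝓕⁻ G‖ = ‖G‖ :=
  (Lp.fourierTransformₗᵢ Plane ℂ).symm.norm_map G

theorem eLpNorm_fourierInv {K : Plane → ℂ} (hK : Integrable K) (hK2 : MemLp K 2) :
    eLpNorm (𝓕⁻ K) 2 = eLpNorm K 2 := by
  rw [← eLpNorm_congr_ae (fourierInv_toLp_ae hK hK2), ← eLpNorm_congr_ae hK2.coeFn_toLp]
  have := Lp.norm_fourierInv_eq (hK2.toLp K)
  rw [Lp.norm_def, Lp.norm_def, ENNReal.toReal_eq_toReal_iff' (Lp.eLpNorm_ne_top _)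
    (Lp.eLpNorm_ne_top _)] at this
  exact this

theorem conj_fourierInv (K : Plane → ℂ) (x : Plane) :
    (starRingEnd ℂ) (𝓕⁻ (fun ξ => (starRingEnd ℂ) (K (-ξ))) x) = 𝓕⁻ K x := by
  rw [Real.fourierInv_eq', Real.fourierInv_eq', ← integral_conj,
    ← integral_neg_eq_self (fun v => Complex.exp _ • K v)]
  refine integral_congr_ae (Eventually.of_forall fun ξ => ?_)
  have h2 : (starRingEnd ℂ) 2 = 2 := map_ofNat _ 2
  simp [← Complex.exp_conj, inner_neg_left, h2]

/-- Parseval's formula for the inverse Fourier transforms of `G ∈ L²` and `K ∈ L¹ ∩ L²`. -/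
theorem integral_fourierInv_mul_fourierInv (G : Lp ℂ 2 (volume : Measure Plane)) {K : Plane → ℂ}
    (hK : Integrable K) (hK2 : MemLp K 2) :
    ∫ x, (𝓕⁻ G : Lp ℂ 2 (volume : Measure Plane)) x * 𝓕⁻ K x = ∫ ξ, G ξ * K (-ξ) := by
  set A : Plane → ℂ := fun ξ => (starRingEnd ℂ) (K (-ξ)) with hA
  have hA1 : Integrable A := (Complex.conjCLE.toContinuousLinearMap.integrable_comp hK.comp_neg)
  have hA2 : MemLp A 2 :=
    (hK2.comp_measurePreserving (Measure.measurePreserving_neg _)).star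
  have h := (Lp.fourierTransformₗᵢ Plane ℂ).symm.inner_map_map (hA2.toLp A) G
  rw [L2.inner_def, L2.inner_def] at h
  have e1 : ∫ x, (𝓕⁻ G : Lp ℂ 2 (volume : Measure Plane)) x * 𝓕⁻ K x =
      ∫ x, inner ℂ (((Lp.fourierTransformₗᵢ Plane ℂ).symm (hA2.toLp A) :
        Lp ℂ 2 (volume : Measure Plane)) x)
        (((Lp.fourierTransformₗᵢ Plane ℂ).symm G : Lp ℂ 2 (volume : Measure Plane)) x) := by
    refine integral_congr_ae ?_
    filter_upwards [fourierInv_toLp_ae hA1 hA2] with x hx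
    have hx' : ((Lp.fourierTransformₗᵢ Plane ℂ).symm (hA2.toLp A) :
        Lp ℂ 2 (volume : Measure Plane)) x = 𝓕⁻ A x := hx
    rw [hx', RCLike.inner_apply, conj_fourierInv]
    rfl
  rw [e1, h]
  refine integral_congr_ae ?_
  filter_upwards [hA2.coeFn_toLp] with x hx
  rw [hx, RCLike.inner_apply, hA]
  simp

/-! ### Translations in `L¹` and vanishing mean at finite energy -/

theorem tendsto_integral_norm_translate_sub {h : Plane → ℂ} (hh : Integrable h) :
    Tendsto (fun c : Plane => ∫ x, ‖h (x - c) - h x‖) (𝓝 0) (𝓝 0) := by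
  have : Fact ((1 : ENNReal) ≠ ⊤) := ⟨ENNReal.one_ne_top⟩
  set f : Lp ℂ 1 (volume : Measure Plane) := hh.toL1 h with hf
  have hc : Tendsto (fun c : Plane => ‖(DomAddAct.mk (-c) +ᵥ f) - f‖) (𝓝 0) (𝓝 0) := by
    have h1 : Continuous (fun c : Plane => ‖(DomAddAct.mk (-c) +ᵥ f) - f‖) := by
      have : Continuous (fun c : Plane => DomAddAct.mk (-c)) :=
        DomAddAct.continuous_mk.comp continuous_neg
      fun_prop
    have h2 := h1.tendsto 0
    have e : (DomAddAct.mk (-(0 : Plane)) : Planeᵈᵃᵃ) = 0 := by simp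
    rwa [e, zero_vadd, sub_self, norm_zero] at h2
  refine hc.congr fun c => ?_
  rw [L1.norm_eq_integral_norm]
  refine integral_congr_ae ?_
  have e1 := DomAddAct.vadd_Lp_ae_eq (DomAddAct.mk (-c)) f
  have e2 := hh.coeFn_toL1
  have e3 :=
    (measurePreserving_sub_right (volume : Measure Plane) c).quasiMeasurePreserving.ae_eq_comp e2
  filter_upwards [Lp.coeFn_sub (DomAddAct.mk (-c) +ᵥ f) f, e1, e2, e3] with x h1 h2 h3 h4
  rw [h1, Pi.sub_apply, h2, h3]
  simp only [Function.comp_apply] at h4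
  rw [← h4]
  simp [sub_eq_neg_add, hf]

theorem norm_integral_mul_le_eLpNorm {α : Type*} [MeasurableSpace α] {μ : Measure α} {F G : α → ℂ}
    (hF : MemLp F 2 μ) (hG : MemLp G 2 μ) :
    ‖∫ x, F x * G x ∂μ‖ ≤ (eLpNorm F 2 μ).toReal * (eLpNorm G 2 μ).toReal := by
  have h1 : ‖∫ x, F x * G x ∂μ‖ₑ ≤ eLpNorm F 2 μ * eLpNorm G 2 μ := by
    refine (enorm_integral_le_lintegral_enorm _).trans ?_
    rw [← eLpNorm_one_eq_lintegral_enorm]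
    have := eLpNorm_smul_le_mul_eLpNorm (𝕜 := ℂ) (p := 2) (q := 2) (r := 1) hG.1 hF.1
    simpa only [smul_eq_mul] using! this
  rw [← ENNReal.toReal_mul, ← toReal_enorm]
  exact ENNReal.toReal_mono (ENNReal.mul_ne_top hF.eLpNorm_ne_top hG.eLpNorm_ne_top) h1

theorem continuous_fourier {h : Plane → ℂ} (hh : Integrable h) : Continuous (𝓕 h) :=
  VectorFourier.fourierIntegral_continuous Real.continuous_fourierChar
    (by simpa using continuous_inner (𝕜 := ℝ) (E := Plane)) hh

theorem norm_fourier_le (h : Plane → ℂ) (ξ : Plane) : ‖𝓕 h ξ‖ ≤ ∫ x, ‖h x‖ :=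
  VectorFourier.norm_fourierIntegral_le_integral_norm _ _ _ _ _

/-- If the continuous function `𝓕 h` were nonzero at the origin, square integrability of the symbol
would make `|ξ|⁻²` integrable near 0. In polar coordinates of the plane this is the divergent
integral of `1/r`. -/
theorem integral_eq_zero_of_memLp_rieszSymbol {h : Plane → ℂ} (hh : Integrable h)
    (hW : MemLp (rieszSymbol h) 2) : ∫ x, h x = 0 := by
  have h0 : 𝓕 h 0 = ∫ x, h x := by simp [Real.fourier_eq']
  by_contra hne
  rw [← h0] at hne
  set c : ℝ := ‖𝓕 h 0‖ with hc
  have hcpos : 0 < c := norm_pos_iff.2 hne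
  have hev : ∀ᶠ ξ in 𝓝 (0 : Plane), c / 2 < ‖𝓕 h ξ‖ :=
    ((continuous_fourier hh).norm.tendsto 0).eventually (lt_mem_nhds (by linarith))
  obtain ⟨δ, hδ, hball⟩ := Metric.eventually_nhds_iff_ball.1 hev
  have hint : IntegrableOn (fun ξ : Plane => ((‖ξ‖ : ℝ) ^ 2)⁻¹) (Metric.ball 0 δ) := by
    have h2 : Integrable (fun ξ => ‖rieszSymbol h ξ‖ ^ 2) := hW.integrable_norm_pow (by norm_num)
    refine ((h2.const_mul ((4 * Real.pi / c) ^ 2)).integrableOn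
      (s := Metric.ball 0 δ)).mono' (by fun_prop) ?_
    filter_upwards [ae_restrict_mem measurableSet_ball] with ξ hξ
    have h3 := hball ξ hξ
    rw [Real.norm_of_nonneg (by positivity), rieszSymbol, norm_div, Complex.norm_real,
      Real.norm_of_nonneg (by positivity), div_pow, mul_pow]
    rcases eq_or_ne ‖ξ‖ 0 with h4 | h4
    · simp [h4]
    · have h5 : 0 < ‖ξ‖ := lt_of_le_of_ne (norm_nonneg _) h4.symm
      have hpi := Real.pi_pos
      rw [div_pow, div_mul_div_comm, inv_eq_one_div, div_le_div_iff₀ (by positivity)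
        (by positivity)]
      have : (c / 2) ^ 2 ≤ ‖𝓕 h ξ‖ ^ 2 := by gcongr
      have h6 : 0 ≤ Real.pi ^ 2 * ‖ξ‖ ^ 2 := by positivity
      nlinarith
  rw [integrableOn_fun_norm_addHaar (volume : Measure Plane) (f := fun y : ℝ => (y ^ 2)⁻¹)] at hint
  have h7 : IntegrableOn (fun y : ℝ => y⁻¹) (Set.Ioo 0 δ) := by
    refine hint.congr_fun (fun y hy => ?_) measurableSet_Ioo
    have : y ≠ 0 := hy.1.ne'
    simp
    field_simp
  have h8 : IntervalIntegrable (fun y : ℝ => y⁻¹) volume 0 δ := by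
    rwa [intervalIntegrable_iff_integrableOn_Ioo_of_le hδ.le]
  rw [intervalIntegrable_inv_iff] at h8
  rcases h8 with h8 | h8
  · exact hδ.ne h8
  · exact h8 Set.left_mem_uIcc

/-! ### Gaussian averages -/

/-- The standard Gaussian `e^{-π|b|²}` on the plane. -/
noncomputable def gauss (b : Plane) : ℝ := Real.exp (-Real.pi * ‖b‖ ^ 2)

theorem gauss_pos (b : Plane) : 0 < gauss b := Real.exp_pos _

theorem gauss_neg (b : Plane) : gauss (-b) = gauss b := by simp [gauss]

theorem continuous_gauss : Continuous gauss := by unfold gauss; fun_prop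

theorem integrable_exp_neg_mul_sq_norm {a : ℝ} (ha : 0 < a) :
    Integrable (fun b : Plane => Real.exp (-a * ‖b‖ ^ 2)) := by
  have := (GaussianFourier.integrable_cexp_neg_mul_sq_norm_add (V := Plane) (b := (a : ℂ))
    (by simpa using ha) 0 0).re
  refine this.congr (Eventually.of_forall fun b => ?_)
  have e : (-(a : ℂ) * (‖b‖ : ℂ) ^ 2 + 0 * ((inner ℝ (0 : Plane) b : ℝ) : ℂ)) =
    ((-a * ‖b‖ ^ 2 : ℝ) : ℂ) := by push_cast; ring
  simp only [e]
  exact Complex.exp_ofReal_re _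

theorem integrable_gauss : Integrable gauss := integrable_exp_neg_mul_sq_norm Real.pi_pos

theorem integral_gauss : ∫ b, gauss b = 1 := by
  have := GaussianFourier.integral_rexp_neg_mul_sq_norm (V := Plane) Real.pi_pos
  simpa [gauss, Real.pi_ne_zero] using this

theorem integrable_gauss_mul_sq : Integrable (fun b => gauss b * ‖b‖ ^ 2) := by
  -- From `t ≤ e^t` with `t = ‖b‖²`, the second moment costs one unit of the exponent `π`.
  refine (integrable_exp_neg_mul_sq_norm (a := Real.pi - 1)
    (by linarith [Real.pi_gt_three])).mono' ?_ (Eventually.of_forall fun b => ?_)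
  · exact (continuous_gauss.mul (by fun_prop)).aestronglyMeasurable
  · rw [Real.norm_of_nonneg (by have := (gauss_pos b).le; positivity), gauss]
    have h1 : ‖b‖ ^ 2 ≤ Real.exp (‖b‖ ^ 2) := by linarith [Real.add_one_le_exp (‖b‖ ^ 2)]
    calc _ ≤ Real.exp (-Real.pi * ‖b‖ ^ 2) * Real.exp (‖b‖ ^ 2) := by gcongr
      _ = _ := by rw [← Real.exp_add]; congr 1; ring

/-- The average of `h` against a Gaussian of width `r`. -/
noncomputable def heat (r : ℝ) (h : Plane → ℂ) (x : Plane) : ℂ :=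
  ∫ b, (gauss b : ℂ) * h (x - r • b)

/-- For each fixed first variable the map is a translation. Joint integrability for Gaussian
averages is pulled back along it from product functions. -/
theorem measurePreserving_shear (r : ℝ) :
    MeasurePreserving (fun p : Plane × Plane => (p.1, p.2 - r • p.1))
      ((volume : Measure Plane).prod volume) ((volume : Measure Plane).prod volume) :=
  MeasurePreserving.skew_product (g := fun b x : Plane => x - r • b)
    (MeasurePreserving.id _) (by fun_prop)
    (Eventually.of_forall fun b => (measurePreserving_sub_right volume (r • b)).map_eq)

theorem integrable_gauss_mul_shear (r : ℝ) {h : Plane → ℂ} (hh : Integrable h) :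
    Integrable (fun p : Plane × Plane => (gauss p.1 : ℂ) * h (p.2 - r • p.1))
      ((volume : Measure Plane).prod volume) :=
  (measurePreserving_shear r).integrable_comp_of_integrable
    (g := fun p : Plane × Plane => (gauss p.1 : ℂ) * h p.2) (integrable_gauss.ofReal.mul_prod hh)

theorem integrable_heat (r : ℝ) {h : Plane → ℂ} (hh : Integrable h) : Integrable (heat r h) :=
  (integrable_gauss_mul_shear r hh).integral_prod_right

section Pairing

variable {u : Plane → ℂ} {M : ℝ}

theorem integrable_gauss_mul_shear_mul (hu : AEStronglyMeasurable u) (hM : ∀ x, ‖u x‖ ≤ M) (r : ℝ)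
    {h : Plane → ℂ} (hh : Integrable h) :
    Integrable (fun p : Plane × Plane => (gauss p.1 : ℂ) * (u p.2 * h (p.2 - r • p.1)))
      ((volume : Measure Plane).prod volume) := by
  have := (integrable_gauss_mul_shear r hh).bdd_mul (c := M)
    (f := fun p : Plane × Plane => u p.2) hu.comp_snd (Eventually.of_forall fun p => hM p.2)
  refine this.congr (Eventually.of_forall fun p => ?_)
  simp only
  ring

theorem integral_mul_heat (hu : AEStronglyMeasurable u) (hM : ∀ x, ‖u x‖ ≤ M) (r : ℝ)
    {h : Plane → ℂ} (hh : Integrable h) :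
    ∫ x, u x * heat r h x = ∫ b, (gauss b : ℂ) * ∫ x, u x * h (x - r • b) := by
  simp only [heat, ← integral_const_mul]
  rw [integral_integral_swap (f := fun x b : Plane => u x * ((gauss b : ℂ) * h (x - r • b)))]
  · refine integral_congr_ae (Eventually.of_forall fun b => ?_)
    refine integral_congr_ae (Eventually.of_forall fun x => ?_)
    simp only
    ring
  · refine (integrable_gauss_mul_shear_mul hu hM r hh).swap.congr (Eventually.of_forall fun p => ?_)
    simp [Function.uncurry]
    ring

theorem integrable_mul_translate (hu : AEStronglyMeasurable u) (hM : ∀ x, ‖u x‖ ≤ M)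
    {h : Plane → ℂ} (hh : Integrable h) (c : Plane) : Integrable (fun x => u x * h (x - c)) :=
  (hh.comp_sub_right c).bdd_mul hu (Eventually.of_forall hM)

theorem norm_integral_mul_translate_le (hM : ∀ x, ‖u x‖ ≤ M)
    {h : Plane → ℂ} (hh : Integrable h) (c : Plane) :
    ‖∫ x, u x * h (x - c)‖ ≤ M * ∫ x, ‖h x‖ := by
  rw [← integral_sub_right_eq_self (fun x => ‖h x‖) c, ← integral_const_mul]
  refine norm_integral_le_of_norm_le ((hh.comp_sub_right c).norm.const_mul M)
    (Eventually.of_forall fun x => ?_)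
  rw [norm_mul]
  gcongr
  exact hM x

/-- Translates of `h` converge in `L¹` and `u` is bounded, so the integrand converges for each `b`;
the Gaussian weight dominates. -/
theorem tendsto_integral_mul_heat_zero (hu : AEStronglyMeasurable u) (hM : ∀ x, ‖u x‖ ≤ M)
    {h : Plane → ℂ} (hh : Integrable h) :
    Tendsto (fun r : ℝ => ∫ x, u x * heat r h x) (𝓝 0) (𝓝 (∫ x, u x * h x)) := by
  simp only [integral_mul_heat hu hM _ hh]
  have hlim : Tendsto (fun c : Plane => ∫ x, u x * h (x - c)) (𝓝 0) (𝓝 (∫ x, u x * h x)) := by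
    rw [tendsto_iff_norm_sub_tendsto_zero]
    have h1 := (tendsto_integral_norm_translate_sub hh).const_mul M
    rw [mul_zero] at h1
    refine squeeze_zero (fun _ => norm_nonneg _) (fun c => ?_) h1
    have h0 := integrable_mul_translate hu hM hh 0
    simp only [sub_zero] at h0
    rw [← integral_sub (integrable_mul_translate hu hM hh c) h0, ← integral_const_mul]
    refine norm_integral_le_of_norm_le (((hh.comp_sub_right c).sub hh).norm.const_mul M)
      (Eventually.of_forall fun x => ?_)
    rw [← mul_sub, norm_mul]
    gcongr
    exact hM x
  have e : ∫ x, u x * h x = ∫ b, (gauss b : ℂ) * ∫ x, u x * h x := by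
    rw [integral_mul_const, integral_complex_ofReal, integral_gauss]
    simp
  rw [e]
  refine tendsto_integral_filter_of_dominated_convergence
    (fun b => gauss b * (M * ∫ x, ‖h x‖)) ?_ ?_ (integrable_gauss.mul_const _) ?_
  · refine Eventually.of_forall fun r => ?_
    have := (integrable_gauss_mul_shear_mul hu hM r hh).integral_prod_left
    simpa only [integral_const_mul] using this.aestronglyMeasurable
  · refine Eventually.of_forall fun r => Eventually.of_forall fun b => ?_
    rw [norm_mul, Complex.norm_real, Real.norm_of_nonneg (gauss_pos b).le]
    exact mul_le_mul_of_nonneg_left (norm_integral_mul_translate_le hM hh _) (gauss_pos b).le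
  · refine Eventually.of_forall fun b => Tendsto.const_mul _ (hlim.comp ?_)
    have : Continuous (fun r : ℝ => r • b) := by fun_prop
    simpa using this.tendsto 0

/-- Moved onto `u`, the average over a wide Gaussian is almost independent of its centre. It
therefore acts on `h` as a constant, and `h` has mean zero. -/
theorem tendsto_integral_mul_heat_atTop (hu : AEStronglyMeasurable u) (hM : ∀ x, ‖u x‖ ≤ M)
    {h : Plane → ℂ} (hh : Integrable h) (h0 : ∫ x, h x = 0) :
    Tendsto (fun r : ℝ => ∫ x, u x * heat r h x) atTop (𝓝 0) := by
  have hM0 : 0 ≤ M := (norm_nonneg _).trans (hM 0)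
  have hint : ∀ r : ℝ, Integrable
      (fun p : Plane × Plane => (gauss p.1 : ℂ) * (u (p.2 + r • p.1) * h p.2))
      ((volume : Measure Plane).prod volume) := by
    intro r
    have := (measurePreserving_shear (-r)).integrable_comp_of_integrable
      (integrable_gauss_mul_shear_mul hu hM r hh)
    simpa [Function.comp_def] using this
  set U : ℝ → Plane → ℂ := fun r y => ∫ b, (gauss b : ℂ) * u (y + r • b) with hU
  have e1 : ∀ r : ℝ, ∫ x, u x * heat r h x = ∫ y, U r y * h y := by
    intro r
    rw [integral_mul_heat hu hM r hh]
    have : ∀ b : Plane, (gauss b : ℂ) * ∫ x, u x * h (x - r • b) =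
        ∫ y, (gauss b : ℂ) * (u (y + r • b) * h y) := by
      intro b
      rw [← integral_add_right_eq_self _ (r • b), ← integral_const_mul]
      simp
    simp only [this]
    rw [integral_integral_swap (hint r)]
    refine integral_congr_ae (Eventually.of_forall fun y => ?_)
    simp only [hU]
    rw [← integral_mul_const]
    simp only [mul_assoc]
  have hUM : ∀ r y, ‖U r y‖ ≤ M := by
    intro r y
    have : M = ∫ b, gauss b * M := by rw [integral_mul_const, integral_gauss, one_mul]
    rw [this]
    refine norm_integral_le_of_norm_le (integrable_gauss.mul_const M)
      (Eventually.of_forall fun b => ?_)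
    rw [norm_mul, Complex.norm_real, Real.norm_of_nonneg (gauss_pos b).le]
    exact mul_le_mul_of_nonneg_left (hM _) (gauss_pos b).le
  have hUm : ∀ r, Integrable (fun y => U r y * h y) := by
    intro r
    refine (hint r).integral_prod_right.congr (Eventually.of_forall fun y => ?_)
    simp only [hU]
    rw [← integral_mul_const]
    simp only [mul_assoc]
  -- The mean-zero hypothesis allows the subtraction of the value at the centre 0, which need not
  -- converge by itself.
  have e2 : ∀ r, ∫ x, u x * heat r h x = ∫ y, (U r y - U r 0) * h y := by
    intro r
    simp only [sub_mul]
    rw [integral_sub (hUm r) (hh.const_mul _), integral_const_mul, h0, e1 r]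
    simp
  simp only [e2]
  have e3 : (0 : ℂ) = ∫ _y : Plane, (0 : ℂ) := by simp
  rw [e3]
  refine tendsto_integral_filter_of_dominated_convergence (fun y => (2 * M) * ‖h y‖) ?_ ?_
    (hh.norm.const_mul _) ?_
  · refine Eventually.of_forall fun r => ?_
    simp only [sub_mul]
    exact ((hUm r).sub (hh.const_mul _)).aestronglyMeasurable
  · refine Eventually.of_forall fun r => Eventually.of_forall fun y => ?_
    rw [norm_mul]
    gcongr
    calc _ ≤ ‖U r y‖ + ‖U r 0‖ := norm_sub_le _ _
      _ ≤ 2 * M := by linarith [hUM r y, hUM r 0]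
  · refine Eventually.of_forall fun y => ?_
    have hg : Integrable (fun b => (gauss b : ℂ)) := integrable_gauss.ofReal
    -- After rescaling, shifting the centre by `y` at width `r` is shifting a fixed Gaussian by `y /
    -- r`, which is small in `L¹`.
    have h1 : Tendsto (fun r : ℝ => M * ∫ b, ‖(gauss (b - r⁻¹ • y) : ℂ) - gauss b‖) atTop (𝓝 0) := by
      have := ((tendsto_integral_norm_translate_sub hg).comp (f := fun r : ℝ => r⁻¹ • y)
        (x := atTop) ?_).const_mul M
      · simpa using this
      · simpa using (tendsto_inv_atTop_zero (𝕜 := ℝ)).smul_const y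
    have h2 : Tendsto (fun r : ℝ => U r y - U r 0) atTop (𝓝 0) := by
      refine squeeze_zero_norm' ?_ h1
      filter_upwards [eventually_gt_atTop 0] with r hr
      have e4 : U r y = ∫ b, (gauss (b - r⁻¹ • y) : ℂ) * u (r • b) := by
        simp only [hU]
        rw [← integral_sub_right_eq_self (fun b => (gauss b : ℂ) * u (y + r • b)) (r⁻¹ • y)]
        refine integral_congr_ae (Eventually.of_forall fun b => ?_)
        simp only [smul_sub, smul_smul, mul_inv_cancel₀ hr.ne', one_smul]
        congr 2
        abel
      have hum : AEStronglyMeasurable (fun b : Plane => u (r • b)) :=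
        hu.comp_quasiMeasurePreserving
          ⟨measurable_const_smul r, by
            rw [Measure.map_addHaar_smul _ hr.ne']
            exact Measure.smul_absolutelyContinuous⟩
      have e5 : U r 0 = ∫ b, (gauss b : ℂ) * u (r • b) := by simp [hU]
      have i1 : Integrable (fun b => (gauss b : ℂ) * u (r • b)) :=
        hg.mul_bdd (c := M) hum (Eventually.of_forall fun b => hM _)
      have i2 : Integrable (fun b => (gauss (b - r⁻¹ • y) : ℂ) * u (r • b)) :=
        (hg.comp_sub_right (r⁻¹ • y)).mul_bdd (c := M) hum (Eventually.of_forall fun b => hM _)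
      rw [e4, e5, ← integral_sub i2 i1, ← integral_const_mul]
      refine norm_integral_le_of_norm_le
        (((hg.comp_sub_right (r⁻¹ • y)).sub hg).norm.const_mul M) (Eventually.of_forall fun b => ?_)
      rw [← sub_mul, norm_mul, mul_comm]
      gcongr
      exact hM _
    simpa using h2.mul_const (h y)

end Pairing

/-! ### Gaussian averages as Fourier multipliers -/

theorem fourier_gauss_smul {r : ℝ} (hr : 0 < r) (x y : Plane) :
    𝓕 (fun ξ : Plane => (Real.exp (-Real.pi * r ^ 2 * ‖ξ‖ ^ 2) : ℂ) *
      Complex.exp (2 * Real.pi * Complex.I * (inner ℝ x ξ : ℝ))) y =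
      ((r ^ 2)⁻¹ : ℝ) * gauss (r⁻¹ • (x - y)) := by
  have h := fourier_gaussian_innerProductSpace' (V := Plane) (b := ((Real.pi * r ^ 2 : ℝ) : ℂ))
    (by rw [Complex.ofReal_re]; positivity) x y
  have e1 : (fun ξ : Plane => (Real.exp (-Real.pi * r ^ 2 * ‖ξ‖ ^ 2) : ℂ) *
      Complex.exp (2 * Real.pi * Complex.I * (inner ℝ x ξ : ℝ))) =
      fun v : Plane => Complex.exp (-((Real.pi * r ^ 2 : ℝ) : ℂ) * (‖v‖ : ℂ) ^ 2 +
        2 * Real.pi * Complex.I * (inner ℝ x v : ℝ)) := by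
    ext ξ
    rw [Complex.ofReal_exp, ← Complex.exp_add]
    congr 1
    push_cast
    ring
  have hpi : (Real.pi : ℂ) ≠ 0 := by exact_mod_cast Real.pi_ne_zero
  have hrc : (r : ℂ) ≠ 0 := by exact_mod_cast hr.ne'
  rw [e1, h, gauss, Complex.ofReal_exp]
  congr 1
  · simp
    field_simp
  · rw [norm_smul, Real.norm_of_nonneg (by positivity)]
    congr 1
    push_cast
    field_simp

theorem integrable_gauss_symbol_mul {r : ℝ} (hr : 0 < r) {k : Plane → ℂ} (hk : Continuous k)
    {C : ℝ} (hC : ∀ ξ, ‖k ξ‖ ≤ C) :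
    Integrable (fun ξ : Plane => (Real.exp (-Real.pi * r ^ 2 * ‖ξ‖ ^ 2) : ℂ) * k ξ) := by
  have h1 : Integrable (fun ξ : Plane => (Real.exp (-Real.pi * r ^ 2 * ‖ξ‖ ^ 2) : ℂ)) := by
    have := (integrable_exp_neg_mul_sq_norm (a := Real.pi * r ^ 2) (by positivity)).ofReal (𝕜 := ℂ)
    simpa only [neg_mul] using! this
  exact h1.mul_bdd (c := C) hk.aestronglyMeasurable (Eventually.of_forall hC)

theorem heat_eq_integral {r : ℝ} (hr : 0 < r) (h : Plane → ℂ) (x : Plane) :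
    heat r h x = ∫ y, h y * (((r ^ 2)⁻¹ : ℝ) * gauss (r⁻¹ • (x - y))) := by
  have e3 := Measure.integral_comp_smul (volume : Measure Plane)
    (fun z : Plane => h (x - z) * gauss (r⁻¹ • z)) r
  simp only [finrank_euclideanSpace, Fintype.card_fin, smul_smul, inv_mul_cancel₀ hr.ne',
    one_smul] at e3
  rw [abs_of_pos (by positivity)] at e3
  rw [heat]
  simp only [mul_comm (gauss _ : ℂ)]
  rw [e3, ← integral_sub_left_eq_self _ (volume : Measure Plane) x, ← integral_smul]
  refine integral_congr_ae (Eventually.of_forall fun y => ?_)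
  simp only [sub_sub_cancel, Complex.real_smul]
  ring

theorem heat_eq_fourierInv {r : ℝ} (hr : 0 < r) {h : Plane → ℂ} (hh : Integrable h) (x : Plane) :
    heat r h x = 𝓕⁻ (fun ξ => (Real.exp (-Real.pi * r ^ 2 * ‖ξ‖ ^ 2) : ℂ) * 𝓕 h ξ) x := by
  set G : Plane → ℂ := fun ξ : Plane => (Real.exp (-Real.pi * r ^ 2 * ‖ξ‖ ^ 2) : ℂ) *
      Complex.exp (2 * Real.pi * Complex.I * (inner ℝ x ξ : ℝ)) with hG
  have hGi : Integrable G := by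
    refine integrable_gauss_symbol_mul hr (by fun_prop) (C := 1) fun ξ => ?_
    rw [Complex.norm_exp]
    simp
  have hsw := VectorFourier.integral_fourierIntegral_smul_eq_flip (μ := (volume : Measure Plane))
    (ν := (volume : Measure Plane)) (L := innerₗ Plane) (e := Real.fourierChar)
    Real.continuous_fourierChar (continuous_inner (𝕜 := ℝ) (E := Plane)) hh hGi
  rw [flip_innerₗ] at hsw
  have e1 : 𝓕⁻ (fun ξ => (Real.exp (-Real.pi * r ^ 2 * ‖ξ‖ ^ 2) : ℂ) * 𝓕 h ξ) x =
      ∫ ξ, 𝓕 h ξ * G ξ := by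
    rw [Real.fourierInv_eq']
    refine integral_congr_ae (Eventually.of_forall fun ξ => ?_)
    have : ((2 * Real.pi * inner ℝ ξ x : ℝ) : ℂ) * Complex.I =
      2 * Real.pi * Complex.I * (inner ℝ x ξ : ℝ) := by
        rw [real_inner_comm]; push_cast; ring
    simp only [hG, smul_eq_mul, this]
    ring
  have e2 : ∫ ξ, 𝓕 h ξ * G ξ = ∫ y, h y * 𝓕 G y := hsw
  rw [e1, e2]
  simp only [hG, fourier_gauss_smul hr, heat_eq_integral hr]

theorem integral_gauss_mul_exp (w : Plane) :
    ∫ b : Plane, (gauss b : ℂ) * Complex.exp (((-2 * Real.pi * inner ℝ b w : ℝ) : ℂ) * Complex.I) =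
      gauss w := by
  have h := fourier_gauss_smul one_pos 0 w
  simp only [inner_zero_left, Complex.ofReal_zero, mul_zero, Complex.exp_zero, mul_one, one_pow,
    inv_one, zero_sub, one_smul, gauss_neg, Complex.ofReal_one, one_mul] at h
  rw [← h, Real.fourier_eq']
  refine integral_congr_ae (Eventually.of_forall fun b => ?_)
  simp only [gauss, smul_eq_mul]
  ring

/-- Here only the function on the frequency side is assumed integrable, so Fubini against the
Gaussian replaces the multiplication formula used in `heat_eq_fourierInv`. -/
theorem heat_fourierInv (r : ℝ) {ψ : Plane → ℂ} (hψ : Integrable ψ) (x : Plane) :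
    heat r (𝓕⁻ ψ) x = 𝓕⁻ (fun ξ => (Real.exp (-Real.pi * r ^ 2 * ‖ξ‖ ^ 2) : ℂ) * ψ ξ) x := by
  set F : Plane → Plane → ℂ := fun b ξ => (gauss b : ℂ) *
    (Complex.exp (((2 * Real.pi * inner ℝ ξ (x - r • b) : ℝ) : ℂ) * Complex.I) * ψ ξ) with hF
  have hFi : Integrable (Function.uncurry F) ((volume : Measure Plane).prod volume) := by
    have h1 : Integrable (fun p : Plane × Plane => (gauss p.1 : ℂ) * ψ p.2)
      ((volume : Measure Plane).prod volume) := integrable_gauss.ofReal.mul_prod hψ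
    have h2 := h1.bdd_mul (c := 1) (f := fun p : Plane × Plane =>
      Complex.exp (((2 * Real.pi * inner ℝ p.2 (x - r • p.1) : ℝ) : ℂ) * Complex.I))
      (by apply Continuous.aestronglyMeasurable; fun_prop)
      (Eventually.of_forall fun p => by rw [Complex.norm_exp_ofReal_mul_I])
    refine h2.congr (Eventually.of_forall fun p => ?_)
    simp only [hF, Function.uncurry]
    ring
  have e1 : heat r (𝓕⁻ ψ) x = ∫ b, ∫ ξ, F b ξ := by
    simp only [heat, hF, Real.fourierInv_eq', smul_eq_mul, integral_const_mul]
  rw [e1, integral_integral_swap hFi, Real.fourierInv_eq']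
  refine integral_congr_ae (Eventually.of_forall fun ξ => ?_)
  have e2 : ∀ b, F b ξ = ((gauss b : ℂ) *
      Complex.exp (((-2 * Real.pi * inner ℝ b (r • ξ) : ℝ) : ℂ) * Complex.I)) *
      (Complex.exp (((2 * Real.pi * inner ℝ ξ x : ℝ) : ℂ) * Complex.I) * ψ ξ) := by
    intro b
    simp only [hF]
    rw [mul_assoc (gauss b : ℂ), ← mul_assoc (Complex.exp _) (Complex.exp _), ← Complex.exp_add]
    congr 3
    rw [inner_sub_right, inner_smul_right, inner_smul_right, real_inner_comm b ξ]
    push_cast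
    ring
  simp only [e2]
  rw [integral_mul_const, integral_gauss_mul_exp, gauss, norm_smul, mul_pow, Real.norm_eq_abs,
    sq_abs, smul_eq_mul]
  ring_nf

/-! ### The duality bound between difference quotients and Coulomb energy -/

/-- Duality bound for the Gaussian Dirichlet form. -/
theorem norm_integral_mul_sub_heat_le {u v : Plane → ℂ} {M A B : ℝ} (hA : 0 ≤ A) (hB : 0 ≤ B)
    (hu : AEStronglyMeasurable u) (hM : ∀ x, ‖u x‖ ≤ M) (hv : Integrable v)
    (huA : ∀ c, eLpNorm (fun x => u x - u (x - c)) 2 ≤ ENNReal.ofReal (A * ‖c‖))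
    (hvB : ∀ c, eLpNorm (fun x => v x - v (x - c)) 2 ≤ ENNReal.ofReal (B * ‖c‖)) (r : ℝ) :
    ‖∫ x, u x * (v x - heat r v x)‖ ≤ A * B * r ^ 2 * (2⁻¹ * ∫ b, gauss b * ‖b‖ ^ 2) := by
  set φ : Plane → ℂ := fun c => ∫ x, u x * v (x - c) with hφ
  have hφ0 : φ 0 = ∫ x, u x * v x := by simp [hφ]
  have hi : ∀ c, Integrable (fun x => u x * v (x - c)) := integrable_mul_translate hu hM hv
  have hi0 : Integrable (fun x => u x * v x) := by simpa using hi 0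
  -- By translation invariance the symmetrised second difference of the correlation `φ` is the
  -- integral of a product of first differences of `u` and `v`, to which Cauchy–Schwarz applies.
  have hJ : ∀ c, ‖(φ 0 - φ c) + (φ 0 - φ (-c))‖ ≤ A * B * ‖c‖ ^ 2 := by
    intro c
    have hum : AEStronglyMeasurable (fun x => u (x - c)) :=
      hu.comp_measurePreserving (measurePreserving_sub_right volume c)
    have hic : Integrable (fun x => u (x - c) * v x) := hv.bdd_mul hum (Eventually.of_forall fun x => hM _)
    have hicc : Integrable (fun x => u (x - c) * v (x - c)) :=
      (hv.comp_sub_right c).bdd_mul hum (Eventually.of_forall fun x => hM _)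
    have e1 : φ 0 = ∫ x, u (x - c) * v (x - c) := by
      rw [hφ0, integral_sub_right_eq_self (fun x => u x * v x) c]
    have e2 : φ (-c) = ∫ x, u (x - c) * v x := by
      simp only [hφ]
      rw [← integral_sub_right_eq_self _ c]
      simp
    have e3 : (φ 0 - φ c) + (φ 0 - φ (-c)) = ∫ x, (u x - u (x - c)) * (v x - v (x - c)) := by
      have : ∀ x, (u x - u (x - c)) * (v x - v (x - c)) =
        (u x * v x - u x * v (x - c)) + (u (x - c) * v (x - c) - u (x - c) * v x) := by
          intro x; ring
      simp only [this]
      have i1 : Integrable (fun x => u x * v x - u x * v (x - c)) := hi0.sub (hi c)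
      have i2 : Integrable (fun x => u (x - c) * v (x - c) - u (x - c) * v x) := hicc.sub hic
      rw [integral_add i1 i2, integral_sub hi0 (hi c), integral_sub hicc hic, ← e1, ← e2, ← hφ0]
    rw [e3]
    have m1 : MemLp (fun x => u x - u (x - c)) 2 :=
      ⟨hu.sub hum, (huA c).trans_lt ENNReal.ofReal_lt_top⟩
    have m2 : MemLp (fun x => v x - v (x - c)) 2 :=
      ⟨hv.1.sub (hv.comp_sub_right c).1, (hvB c).trans_lt ENNReal.ofReal_lt_top⟩
    refine (norm_integral_mul_le_eLpNorm m1 m2).trans ?_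
    have n1 := ENNReal.toReal_le_of_le_ofReal (by positivity) (huA c)
    have n2 := ENNReal.toReal_le_of_le_ofReal (by positivity) (hvB c)
    calc _ ≤ (A * ‖c‖) * (B * ‖c‖) := by gcongr
      _ = _ := by ring
  have hgφ : Integrable (fun b => (gauss b : ℂ) * φ (r • b)) := by
    have := (integrable_gauss_mul_shear_mul hu hM r hv).integral_prod_left
    simpa only [integral_const_mul] using this
  have hg0 : Integrable (fun b => (gauss b : ℂ) * φ 0) := integrable_gauss.ofReal.mul_const _
  have hD : Integrable (fun b => (gauss b : ℂ) * (φ 0 - φ (r • b))) := by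
    simp only [mul_sub]
    exact hg0.sub hgφ
  have e4 : ∫ x, u x * (v x - heat r v x) = ∫ b, (gauss b : ℂ) * (φ 0 - φ (r • b)) := by
    simp only [mul_sub]
    rw [integral_sub hi0 ((integrable_heat r hv).bdd_mul hu (Eventually.of_forall hM)),
      integral_mul_heat hu hM r hv, integral_sub hg0 hgφ, integral_mul_const,
      integral_complex_ofReal, integral_gauss, hφ0]
    simp [hφ]
  -- Evenness of the Gaussian permits averaging over `b` and `-b`, hence the factor `2⁻¹`.
  have e5 : ∫ b, (gauss b : ℂ) * (φ 0 - φ (r • b)) =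
      2⁻¹ * ∫ b, (gauss b : ℂ) * ((φ 0 - φ (r • b)) + (φ 0 - φ (-(r • b)))) := by
    have hneg : ∫ b, (gauss b : ℂ) * (φ 0 - φ (-(r • b))) =
        ∫ b, (gauss b : ℂ) * (φ 0 - φ (r • b)) := by
      rw [← integral_neg_eq_self]
      simp [gauss_neg]
    have hDn : Integrable (fun b => (gauss b : ℂ) * (φ 0 - φ (-(r • b)))) := by
      simpa [gauss_neg] using hD.comp_neg
    simp only [mul_add]
    rw [integral_add hD hDn, hneg]
    ring
  rw [e4, e5, norm_mul, norm_inv, Complex.norm_ofNat]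
  have : ‖∫ b, (gauss b : ℂ) * ((φ 0 - φ (r • b)) + (φ 0 - φ (-(r • b))))‖ ≤
      ∫ b, A * B * r ^ 2 * (gauss b * ‖b‖ ^ 2) := by
    refine norm_integral_le_of_norm_le (integrable_gauss_mul_sq.const_mul _)
      (Eventually.of_forall fun b => ?_)
    rw [norm_mul, Complex.norm_real, Real.norm_of_nonneg (gauss_pos b).le]
    have := mul_le_mul_of_nonneg_left (hJ (r • b)) (gauss_pos b).le
    refine this.trans_eq ?_
    rw [norm_smul, mul_pow, Real.norm_eq_abs, sq_abs]
    ring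
  rw [integral_const_mul] at this
  linarith

/-- A geometric series with ratio `q = e^{-x}`, where `x q ≤ 1 - q` follows from `1 + x ≤ e^x`. It
is a discrete form of `x ∫₀^∞ e^{-tx} dt = 1`: sums of Gaussian multipliers are controlled by an
inverse Laplacian, uniformly in the number of terms. -/
theorem mul_sum_exp_neg_le (N : ℕ) (x : ℝ) :
    x * ∑ n ∈ Finset.range N, Real.exp (-((n : ℝ) + 1) * x) ≤ 1 := by
  set q := Real.exp (-x) with hq
  have hq0 : 0 < q := Real.exp_pos _
  have e : ∑ n ∈ Finset.range N, Real.exp (-((n : ℝ) + 1) * x) =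
      q * ∑ n ∈ Finset.range N, q ^ n := by
    rw [Finset.mul_sum]
    refine Finset.sum_congr rfl fun n _ => ?_
    rw [hq, ← Real.exp_nat_mul, ← Real.exp_add]
    congr 1
    ring
  have hxq : x * q ≤ 1 - q := by
    have h1 := Real.add_one_le_exp x
    have h2 : q * Real.exp x = 1 := by rw [hq, ← Real.exp_add]; simp
    nlinarith
  rw [e, ← mul_assoc]
  have hs : 0 ≤ ∑ n ∈ Finset.range N, q ^ n := Finset.sum_nonneg fun n _ => by positivity
  calc x * q * ∑ n ∈ Finset.range N, q ^ n ≤ (1 - q) * ∑ n ∈ Finset.range N, q ^ n := by gcongr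
    _ = 1 - q ^ N := mul_neg_geom_sum q N
    _ ≤ 1 := by linarith [pow_pos hq0 N]

theorem fourierInv_sub_translate {K : Plane → ℂ} (hK : Integrable K) (x c : Plane) :
    𝓕⁻ K x - 𝓕⁻ K (x - c) = 𝓕⁻ (fun ξ => (1 - Complex.exp (Complex.I *
      ((-2 * Real.pi * inner ℝ ξ c : ℝ) : ℂ))) * K ξ) x := by
  have hb : ∀ y : Plane, Integrable (fun ξ : Plane =>
      Complex.exp (((2 * Real.pi * inner ℝ ξ y : ℝ) : ℂ) * Complex.I) • K ξ) := fun y =>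
    hK.bdd_mul (c := 1) (by apply Continuous.aestronglyMeasurable; fun_prop)
      (Eventually.of_forall fun ξ => by rw [Complex.norm_exp_ofReal_mul_I])
  simp only [Real.fourierInv_eq']
  rw [← integral_sub (hb x) (hb (x - c))]
  refine integral_congr_ae (Eventually.of_forall fun ξ => ?_)
  have : Complex.exp (((2 * Real.pi * inner ℝ ξ (x - c) : ℝ) : ℂ) * Complex.I) =
      Complex.exp (((2 * Real.pi * inner ℝ ξ x : ℝ) : ℂ) * Complex.I) *
      Complex.exp (Complex.I * ((-2 * Real.pi * inner ℝ ξ c : ℝ) : ℂ)) := by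
    rw [← Complex.exp_add, inner_sub_right]
    congr 1
    push_cast
    ring
  simp only [this, smul_eq_mul]
  ring

/-- A bounded function whose difference quotients are bounded in `L²` acts continuously on the
Coulomb space. -/
theorem norm_integral_mul_le_of_difference {u h : Plane → ℂ} {M A : ℝ} (hA : 0 ≤ A)
    (hu : AEStronglyMeasurable u) (hM : ∀ x, ‖u x‖ ≤ M)
    (huA : ∀ c, eLpNorm (fun x => u x - u (x - c)) 2 ≤ ENNReal.ofReal (A * ‖c‖))
    (hh : Integrable h) (hW : MemLp (rieszSymbol h) 2) :
    ‖∫ x, u x * h x‖ ≤ A * (eLpNorm (rieszSymbol h) 2).toReal *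
      (2 * Real.pi * ∫ b, gauss b * ‖b‖ ^ 2) := by
  set c₀ : ℝ := ∫ b, gauss b * ‖b‖ ^ 2
  set w : ℝ := (eLpNorm (rieszSymbol h) 2).toReal with hw
  have key : ∀ r : ℝ, 0 < r → ∀ N : ℕ,
      ‖(∫ x, u x * heat r h x) - ∫ x, u x * heat (r * Real.sqrt (N + 1)) h x‖ ≤
        A * w * (2 * Real.pi * c₀) := by
    intro r hr N
    set σ : ℝ → Plane → ℂ := fun s ξ => (Real.exp (-Real.pi * s ^ 2 * ‖ξ‖ ^ 2) : ℂ) * 𝓕 h ξ with hσ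
    have hσi : ∀ s, 0 < s → Integrable (σ s) := fun s hs =>
      integrable_gauss_symbol_mul hs (continuous_fourier hh) (norm_fourier_le h)
    -- With these widths the squares are in arithmetic progression, so one further average of width
    -- `r` sends term `n` to term `n + 1` and the sum `v` telescopes.
    set ρ : ℕ → ℝ := fun n => r * Real.sqrt (n + 1) with hρ
    have hρpos : ∀ n, 0 < ρ n := fun n => by simp only [hρ]; positivity
    have hρsq : ∀ n, ρ n ^ 2 = r ^ 2 * (n + 1) := fun n => by
      simp only [hρ]; rw [mul_pow, Real.sq_sqrt (by positivity)]
    set Ψ : Plane → ℂ := fun ξ => ∑ n ∈ Finset.range N, σ (ρ n) ξ with hΨ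
    have hΨi : Integrable Ψ := integrable_finsetSum _ fun n _ => hσi _ (hρpos n)
    have hfi : ∀ s, 0 < s → ∀ x, 𝓕⁻ (σ s) x = heat s h x := fun s hs x =>
      (heat_eq_fourierInv hs hh x).symm
    set v : Plane → ℂ := 𝓕⁻ Ψ with hv
    have hexpi : ∀ {K : Plane → ℂ}, Integrable K → ∀ x : Plane, Integrable (fun ξ : Plane =>
      Complex.exp (((2 * Real.pi * inner ℝ ξ x : ℝ) : ℂ) * Complex.I) • K ξ) := fun hK x =>
      hK.bdd_mul (c := 1) (by apply Continuous.aestronglyMeasurable; fun_prop)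
        (Eventually.of_forall fun ξ => by rw [Complex.norm_exp_ofReal_mul_I])
    have hvsum : v = fun x => ∑ n ∈ Finset.range N, heat (ρ n) h x := by
      ext x
      simp only [hv, ← hfi _ (hρpos _), Real.fourierInv_eq']
      rw [← integral_finsetSum _ fun n _ => hexpi (hσi _ (hρpos n)) x]
      simp only [hΨ, Finset.smul_sum]
    have hvi : Integrable v := by
      rw [hvsum]
      exact integrable_finsetSum _ fun n _ => integrable_heat _ hh
    have hvheat : ∀ x, v x - heat r v x = heat r h x - heat (ρ N) h x := by
      intro x
      have hΨr : Integrable (fun ξ : Plane => (Real.exp (-Real.pi * r ^ 2 * ‖ξ‖ ^ 2) : ℂ) * Ψ ξ) := by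
        refine hΨi.bdd_mul (c := 1) (by apply Continuous.aestronglyMeasurable; fun_prop)
          (Eventually.of_forall fun ξ => ?_)
        rw [Complex.norm_real, Real.norm_of_nonneg (Real.exp_pos _).le, Real.exp_le_one_iff]
        have : 0 ≤ Real.pi * r ^ 2 * ‖ξ‖ ^ 2 := by positivity
        linarith
      rw [hv, heat_fourierInv r hΨi, ← hfi r hr, ← hfi _ (hρpos N)]
      simp only [Real.fourierInv_eq']
      rw [← integral_sub (hexpi hΨi x) (hexpi hΨr x),
        ← integral_sub (hexpi (hσi r hr) x) (hexpi (hσi _ (hρpos N)) x)]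
      refine integral_congr_ae (Eventually.of_forall fun ξ => ?_)
      simp only [← smul_sub]
      congr 1
      set τ : ℕ → ℂ := fun n => σ (ρ n) ξ with hτ
      have hstep : ∀ n, (Real.exp (-Real.pi * r ^ 2 * ‖ξ‖ ^ 2) : ℂ) * σ (ρ n) ξ = τ (n + 1) := by
        intro n
        simp only [hτ, hσ]
        rw [← mul_assoc, ← Complex.ofReal_mul, ← Real.exp_add, hρsq, hρsq]
        congr 3
        push_cast
        ring
      have h0 : σ r ξ = τ 0 := by
        simp only [hτ, hσ, hρsq]
        simp
      simp only [hΨ, Finset.mul_sum, hstep, h0]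
      rw [← Finset.sum_sub_distrib]
      exact Finset.sum_range_sub' τ N
    have hw0 : 0 ≤ w := ENNReal.toReal_nonneg
    have hpi := Real.pi_pos
    -- Translation contributes `2π|ξ||c|` and the multiplier sum is at most `1/(π r²|ξ|²)`. Their
    -- product with `𝓕 h` is `4π|c|/r²` times the symbol, uniformly in `N`.
    have hvB : ∀ c, eLpNorm (fun x => v x - v (x - c)) 2 ≤
        ENNReal.ofReal ((4 * Real.pi / r ^ 2 * w) * ‖c‖) := by
      intro c
      set Kc : Plane → ℂ := fun ξ => (1 - Complex.exp (Complex.I *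
        ((-2 * Real.pi * inner ℝ ξ c : ℝ) : ℂ))) * Ψ ξ with hKc
      have hKci : Integrable Kc := by
        refine hΨi.bdd_mul (c := 2) (by apply Continuous.aestronglyMeasurable; fun_prop)
          (Eventually.of_forall fun ξ => ?_)
        refine (norm_sub_le _ _).trans ?_
        rw [norm_one, Complex.norm_exp_I_mul_ofReal]
        norm_num
      have hbound : ∀ᵐ ξ, ‖Kc ξ‖ ≤ (4 * Real.pi / r ^ 2 * ‖c‖) * ‖rieszSymbol h ξ‖ := by
        have hne : ∀ᵐ ξ : Plane, ξ ≠ 0 := by simp [ae_iff, measure_singleton]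
        filter_upwards [hne] with ξ hξ
        have hξ' : 0 < ‖ξ‖ := norm_pos_iff.2 hξ
        have b1 : ‖1 - Complex.exp (Complex.I * ((-2 * Real.pi * inner ℝ ξ c : ℝ) : ℂ))‖ ≤
            2 * Real.pi * (‖ξ‖ * ‖c‖) := by
          rw [norm_sub_rev]
          refine Real.norm_exp_I_mul_ofReal_sub_one_le.trans ?_
          rw [norm_mul, norm_mul, norm_neg, Real.norm_ofNat, Real.norm_of_nonneg hpi.le]
          gcongr
          exact norm_inner_le_norm _ _
        have b2 : ‖Ψ ξ‖ ≤ (∑ n ∈ Finset.range N,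
            Real.exp (-((n : ℝ) + 1) * (Real.pi * r ^ 2 * ‖ξ‖ ^ 2))) * ‖𝓕 h ξ‖ := by
          rw [hΨ, Finset.sum_mul]
          refine norm_sum_le_of_le _ fun n _ => ?_
          rw [hσ]
          simp only
          rw [norm_mul, Complex.norm_real, Real.norm_of_nonneg (Real.exp_pos _).le, hρsq]
          apply le_of_eq
          congr 2
          ring
        have b3 := mul_sum_exp_neg_le N (Real.pi * r ^ 2 * ‖ξ‖ ^ 2)
        set S := ∑ n ∈ Finset.range N, Real.exp (-((n : ℝ) + 1) * (Real.pi * r ^ 2 * ‖ξ‖ ^ 2))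
        rw [hKc, norm_mul, rieszSymbol, norm_div, Complex.norm_real,
          Real.norm_of_nonneg (by positivity : 0 ≤ 2 * Real.pi * ‖ξ‖)]
        calc _ ≤ (2 * Real.pi * (‖ξ‖ * ‖c‖)) * (S * ‖𝓕 h ξ‖) := by gcongr
          _ = (2 / (r ^ 2 * ‖ξ‖) * ‖c‖ * ‖𝓕 h ξ‖) * (Real.pi * r ^ 2 * ‖ξ‖ ^ 2 * S) := by
            field_simp
          _ ≤ (2 / (r ^ 2 * ‖ξ‖) * ‖c‖ * ‖𝓕 h ξ‖) * 1 := by gcongr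
          _ = _ := by field_simp; ring
      have hle : eLpNorm Kc 2 ≤ ENNReal.ofReal (4 * Real.pi / r ^ 2 * ‖c‖) *
          eLpNorm (rieszSymbol h) 2 := eLpNorm_le_mul_eLpNorm_of_ae_le_mul hbound 2
      have hK2 : MemLp Kc 2 := ⟨hKci.1, hle.trans_lt
        (ENNReal.mul_lt_top ENNReal.ofReal_lt_top hW.eLpNorm_lt_top)⟩
      have e : (fun x => v x - v (x - c)) = 𝓕⁻ Kc := by
        ext x
        exact fourierInv_sub_translate hΨi x c
      rw [e, eLpNorm_fourierInv hKci hK2]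
      refine hle.trans_eq ?_
      rw [← ENNReal.ofReal_toReal hW.eLpNorm_ne_top, ← ENNReal.ofReal_mul (by positivity)]
      congr 1
      rw [← hw]
      ring
    have := norm_integral_mul_sub_heat_le hA (by positivity) hu hM hvi huA hvB r
    simp only [hvheat, mul_sub] at this
    rw [integral_sub ((integrable_heat r hh).bdd_mul hu (Eventually.of_forall hM))
      ((integrable_heat (ρ N) hh).bdd_mul hu (Eventually.of_forall hM))] at this
    -- The factor `r⁻²` in the bound on `v` cancels the `r²` of the Dirichlet form, so the constant
    -- depends on neither `r` nor `N`.
    refine this.trans_eq ?_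
    field_simp
    ring
  have key2 : ∀ r : ℝ, 0 < r → ‖∫ x, u x * heat r h x‖ ≤ A * w * (2 * Real.pi * c₀) := by
    intro r hr
    have h1 : Tendsto (fun N : ℕ => r * Real.sqrt ((N : ℝ) + 1)) atTop atTop :=
      (Real.tendsto_sqrt_atTop.comp
        (tendsto_atTop_add_const_right _ 1 tendsto_natCast_atTop_atTop)).const_mul_atTop hr
    have h2 := (tendsto_integral_mul_heat_atTop hu hM hh
      (integral_eq_zero_of_memLp_rieszSymbol hh hW)).comp h1
    have h3 := (h2.const_sub (∫ x, u x * heat r h x)).norm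
    rw [sub_zero] at h3
    exact le_of_tendsto h3 (Eventually.of_forall fun N => key r hr N)
  have h4 := ((tendsto_integral_mul_heat_zero hu hM hh).mono_left
    (nhdsWithin_le_nhds (s := Set.Ioi (0 : ℝ)))).norm
  exact le_of_tendsto h4 (eventually_mem_nhdsWithin.mono fun r hr => key2 r hr)

/-! ### Size of the modified Riesz kernel -/

theorem integrable_indicator_inv_norm :
    Integrable ((Metric.ball (0 : Plane) 1).indicator fun z => ‖z‖⁻¹) := by
  rw [integrable_indicator_iff measurableSet_ball,
    integrableOn_fun_norm_addHaar (volume : Measure Plane) (f := fun y : ℝ => y⁻¹)]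
  have h1 : IntegrableOn (fun _ : ℝ => (1 : ℝ)) (Set.Ioo 0 1) := by simp
  refine h1.congr_fun (fun y hy => ?_) measurableSet_Ioo
  have : y ≠ 0 := hy.1.ne'
  simp [this]

/-- The mass of `1 / |z|` on the unit disc. -/
noncomputable def invNormMass : ℝ :=
  ∫ z, (Metric.ball (0 : Plane) 1).indicator (fun z => ‖z‖⁻¹) z

section InvNorm

variable {F : Plane → ℂ} {C : ℝ}

theorem norm_inv_norm_mul_le (hC : ∀ x, ‖F x‖ ≤ C) (x y : Plane) :
    ‖((1 / ‖x - y‖ : ℝ) : ℂ) * F x‖ ≤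
      C * (Metric.ball (0 : Plane) 1).indicator (fun z => ‖z‖⁻¹) (x - y) + ‖F x‖ := by
  have hC0 : 0 ≤ C := (norm_nonneg _).trans (hC 0)
  rw [norm_mul, Complex.norm_real, Real.norm_of_nonneg (by positivity), one_div]
  by_cases h : x - y ∈ Metric.ball (0 : Plane) 1
  · rw [Set.indicator_of_mem h, mul_comm]
    have := mul_le_mul_of_nonneg_right (hC x) (inv_nonneg.2 (norm_nonneg (x - y)))
    linarith [norm_nonneg (F x)]
  · rw [Set.indicator_of_notMem h, mul_zero, zero_add]
    have h1 : 1 ≤ ‖x - y‖ := by simpa using h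
    exact mul_le_of_le_one_left (norm_nonneg _) (inv_le_one_of_one_le₀ h1)

theorem integrable_inv_norm_mul (hF : Integrable F) (hC : ∀ x, ‖F x‖ ≤ C) (y : Plane) :
    Integrable (fun x => ((1 / ‖x - y‖ : ℝ) : ℂ) * F x) := by
  refine (((integrable_indicator_inv_norm.comp_sub_right y).const_mul C).add hF.norm).mono'
    (AEStronglyMeasurable.mul (by apply Measurable.aestronglyMeasurable; fun_prop) hF.1)
    (Eventually.of_forall fun x => norm_inv_norm_mul_le hC x y)

theorem integral_norm_inv_norm_mul_le (hF : Integrable F) (hC : ∀ x, ‖F x‖ ≤ C) (y : Plane) :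
    ∫ x, ‖((1 / ‖x - y‖ : ℝ) : ℂ) * F x‖ ≤ C * invNormMass + ∫ x, ‖F x‖ := by
  have h1 := (integrable_indicator_inv_norm.comp_sub_right y).const_mul C
  calc _ ≤ ∫ x, (C * (Metric.ball (0 : Plane) 1).indicator (fun z => ‖z‖⁻¹) (x - y) + ‖F x‖) :=
        integral_mono (integrable_inv_norm_mul hF hC y).norm (h1.add hF.norm)
          fun x => norm_inv_norm_mul_le hC x y
    _ = _ := by
        rw [integral_add h1 hF.norm, integral_const_mul, invNormMass,
          integral_sub_right_eq_self ((Metric.ball (0 : Plane) 1).indicator fun z => ‖z‖⁻¹) y]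

end InvNorm

/-- The kernel of the modified Riesz potential `ℐ₁ + ℐ₂`, without the factor `(2π)⁻¹`. -/
noncomputable def rieszKernel (x y : Plane) : ℝ :=
  if ‖y‖ < 1 then 1 / ‖x - y‖ else 1 / ‖x - y‖ - 1 / ‖y‖

theorem measurable_rieszKernel :
    Measurable (fun p : Plane × Plane => rieszKernel p.1 p.2) := by
  unfold rieszKernel
  refine Measurable.ite (measurableSet_lt (by fun_prop) (by fun_prop)) (by fun_prop) (by fun_prop)

/-- For `|y| ≥ 1` the subtraction gains a power: the difference is at most `|x| / (|x - y||y|)`, and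
`|y| ≤ |x - y| + |x|` trades the missing `|y|` for growth in `x`. The resulting decay `(1 + |y|)⁻²`
is square integrable in the plane, as pairing with an `L²` function requires. -/
theorem abs_rieszKernel_le {x y : Plane} (hxy : x ≠ y) :
    |rieszKernel x y| ≤ 4 * ((1 + ‖y‖) ^ 2)⁻¹ * ((1 + 1 / ‖x - y‖) * (1 + ‖x‖) ^ 2) := by
  have hd : 0 < ‖x - y‖ := norm_pos_iff.2 (sub_ne_zero.2 hxy)
  have hx := norm_nonneg x
  have hy := norm_nonneg y
  set d := ‖x - y‖
  have htri : ‖y‖ ≤ d + ‖x‖ := by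
    have := norm_sub_norm_le y x
    rw [norm_sub_rev] at this
    linarith
  rw [rieszKernel]
  split_ifs with h
  · rw [abs_of_nonneg (by positivity)]
    have h1 : 1 ≤ 4 * ((1 + ‖y‖) ^ 2)⁻¹ := by
      rw [← div_eq_mul_inv, le_div_iff₀ (by positivity)]
      nlinarith
    have h2 : (1 : ℝ) ≤ (1 + ‖x‖) ^ 2 := by nlinarith
    have h3 : 0 ≤ 1 / d := by positivity
    calc 1 / d ≤ (1 + 1 / d) := by linarith
      _ ≤ (1 + 1 / d) * (1 + ‖x‖) ^ 2 := le_mul_of_one_le_right (by positivity) h2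
      _ ≤ _ := le_mul_of_one_le_left (by positivity) h1
  · rw [not_lt] at h
    have hy1 : 0 < ‖y‖ := by linarith
    have h1 : |1 / d - 1 / ‖y‖| ≤ ‖x‖ / (d * ‖y‖) := by
      rw [div_sub_div _ _ hd.ne' hy1.ne', abs_div, abs_of_pos (mul_pos hd hy1), one_mul, mul_one]
      gcongr
      rw [abs_le]
      refine ⟨?_, by linarith⟩
      have := norm_sub_le x y
      change d ≤ _ at this
      linarith
    have h2 : (‖y‖ ^ 2)⁻¹ ≤ 4 * ((1 + ‖y‖) ^ 2)⁻¹ := by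
      rw [← div_eq_mul_inv, inv_eq_one_div, div_le_div_iff₀ (by positivity) (by positivity)]
      nlinarith
    refine h1.trans ?_
    calc ‖x‖ / (d * ‖y‖) = (‖y‖ ^ 2)⁻¹ * (‖x‖ * (‖y‖ / d)) := by field_simp
      _ ≤ (4 * ((1 + ‖y‖) ^ 2)⁻¹) * (‖x‖ * ((d + ‖x‖) / d)) := by gcongr
      _ ≤ _ := by
        refine mul_le_mul_of_nonneg_left ?_ (by positivity)
        have e : (d + ‖x‖) / d = 1 + ‖x‖ * (1 / d) := by field_simp
        rw [e]
        have h3 : 0 ≤ 1 / d := by positivity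
        have h4 : 0 ≤ ‖x‖ * (1 / d) := by positivity
        nlinarith

theorem integrable_inv_one_add_norm_pow_four :
    Integrable (fun x : Plane => ((1 + ‖x‖) ^ 4)⁻¹) := by
  have := integrable_one_add_norm (E := Plane) (μ := volume) (r := 4) (by simp; norm_num)
  refine this.congr (Eventually.of_forall fun x => ?_)
  simp only
  rw [Real.rpow_neg (by positivity)]
  norm_cast

theorem memLp_two_inv_one_add_norm_sq :
    MemLp (fun y : Plane => ((1 + ‖y‖) ^ 2)⁻¹) 2 := by
  rw [memLp_two_iff_integrable_sq (by apply Measurable.aestronglyMeasurable; fun_prop)]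
  refine integrable_inv_one_add_norm_pow_four.congr (Eventually.of_forall fun y => ?_)
  simp only
  rw [inv_pow, ← pow_mul]

/-- Of the six powers of decay of `s`, two absorb the growth of the kernel in `x` and four leave a
bounded integrable weight. The `x`-integral against `1 + 1/|x - y|` is then bounded uniformly in
`y`, and Cauchy–Schwarz handles the `y`-integral. -/
theorem integrable_rieszKernel_mul {g s : Plane → ℂ} (hg : MemLp g 2) (hs : AEStronglyMeasurable s)
    {C : ℝ} (hC : ∀ x, ‖s x‖ ≤ C * ((1 + ‖x‖) ^ 6)⁻¹) :
    Integrable (fun p : Plane × Plane => (rieszKernel p.1 p.2 : ℂ) * g p.2 * s p.1)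
      ((volume : Measure Plane).prod volume) := by
  have hC0 : 0 ≤ C := by
    have := (norm_nonneg _).trans (hC 0)
    simpa using this
  set w : Plane → ℂ := fun x => (((1 + ‖x‖) ^ 4)⁻¹ : ℝ) with hw
  have hwn : ∀ x, ‖w x‖ = ((1 + ‖x‖) ^ 4)⁻¹ := fun x => by
    rw [hw, Complex.norm_real, Real.norm_of_nonneg (by positivity)]
  have hwi : Integrable w := integrable_inv_one_add_norm_pow_four.ofReal
  have hw1 : ∀ x, ‖w x‖ ≤ 1 := fun x => by
    rw [hwn]
    exact inv_le_one_of_one_le₀ (one_le_pow₀ (by linarith [norm_nonneg x]))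
  set K : ℝ := (1 * invNormMass + ∫ x, ‖w x‖) + ∫ x, ‖w x‖ with hK
  have hbound : ∀ y, ∀ᵐ x, ‖(rieszKernel x y : ℂ) * g y * s x‖ ≤
      (4 * C * ((1 + ‖y‖) ^ 2)⁻¹ * ‖g y‖) * (‖((1 / ‖x - y‖ : ℝ) : ℂ) * w x‖ + ‖w x‖) := by
    intro y
    have hne : ∀ᵐ x : Plane, x ≠ y := by simp [ae_iff, measure_singleton]
    filter_upwards [hne] with x hx
    rw [norm_mul, norm_mul, norm_mul, Complex.norm_real, Complex.norm_real, hwn, Real.norm_eq_abs,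
      Real.norm_of_nonneg (by positivity : 0 ≤ 1 / ‖x - y‖)]
    calc _ ≤ (4 * ((1 + ‖y‖) ^ 2)⁻¹ * ((1 + 1 / ‖x - y‖) * (1 + ‖x‖) ^ 2)) * ‖g y‖ *
          (C * ((1 + ‖x‖) ^ 6)⁻¹) := by
            gcongr
            · exact abs_rieszKernel_le hx
            · exact hC x
      _ = _ := by
        have : 1 + ‖x‖ ≠ 0 := by positivity
        field_simp
        ring
  have hmaj : ∀ y, Integrable (fun x => (4 * C * ((1 + ‖y‖) ^ 2)⁻¹ * ‖g y‖) *
      (‖((1 / ‖x - y‖ : ℝ) : ℂ) * w x‖ + ‖w x‖)) := fun y =>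
    ((integrable_inv_norm_mul hwi hw1 y).norm.add hwi.norm).const_mul _
  have hmeas : AEStronglyMeasurable
      (fun p : Plane × Plane => (rieszKernel p.1 p.2 : ℂ) * g p.2 * s p.1)
      ((volume : Measure Plane).prod volume) :=
    ((Complex.measurable_ofReal.comp measurable_rieszKernel).aestronglyMeasurable.mul
      hg.1.comp_snd).mul hs.comp_fst
  have hmeas_y : ∀ y, AEStronglyMeasurable (fun x => (rieszKernel x y : ℂ) * g y * s x) := fun y =>
    ((Complex.measurable_ofReal.comp (measurable_rieszKernel.comp
      (measurable_id.prodMk measurable_const))).aestronglyMeasurable.mul_const _).mul hs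
  rw [integrable_prod_iff' hmeas]
  refine ⟨Eventually.of_forall fun y => (hmaj y).mono' (hmeas_y y) (hbound y), ?_⟩
  have hgi : Integrable (fun y => (4 * C * K) * (((1 + ‖y‖) ^ 2)⁻¹ * ‖g y‖)) :=
    (memLp_two_inv_one_add_norm_sq.integrable_mul hg.norm).const_mul _
  refine hgi.mono' ?_ (Eventually.of_forall fun y => ?_)
  · exact hmeas.norm.prod_swap.integral_prod_right'
  · rw [Real.norm_of_nonneg (integral_nonneg fun x => norm_nonneg _)]
    refine (integral_mono_ae ((hmaj y).mono' (hmeas_y y) (hbound y)).norm (hmaj y)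
      (hbound y)).trans ?_
    rw [integral_const_mul, integral_add (integrable_inv_norm_mul hwi hw1 y).norm hwi.norm]
    have h1 := integral_norm_inv_norm_mul_le hwi hw1 y
    have h2 : 0 ≤ 4 * C * ((1 + ‖y‖) ^ 2)⁻¹ * ‖g y‖ := by positivity
    calc _ ≤ (4 * C * ((1 + ‖y‖) ^ 2)⁻¹ * ‖g y‖) * K := by
          refine mul_le_mul_of_nonneg_left ?_ h2
          rw [hK]
          linarith
      _ = _ := by ring

/-! ### Convergence of the potential and Fubini -/

section Potential

variable (f : Plane → ℂ)

/-- Fubini with the nowhere-vanishing weight `(1 + ‖x‖)⁻⁶`, which is divided out afterwards. -/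
theorem ae_integrable_rieszKernel :
    ∀ᵐ x : Plane, Integrable (fun y => (rieszKernel x y : ℂ) * coulombW f y) := by
  have h := integrable_rieszKernel_mul (Lp.memLp (coulombW f))
    (s := fun x => (((1 + ‖x‖) ^ 6)⁻¹ : ℝ)) (C := 1)
    (by apply Measurable.aestronglyMeasurable; fun_prop) fun x => by
      rw [Complex.norm_real, Real.norm_of_nonneg (by positivity), one_mul]
  filter_upwards [h.prod_right_ae] with x hx
  have hne : ((((1 + ‖x‖) ^ 6)⁻¹ : ℝ) : ℂ) ≠ 0 := by
    rw [Complex.ofReal_ne_zero]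
    positivity
  exact (hx.mul_const (((((1 + ‖x‖) ^ 6)⁻¹ : ℝ) : ℂ)⁻¹)).congr
    (Eventually.of_forall fun y => mul_inv_cancel_right₀ hne _)

theorem ae_integrableOn_rieszKernels :
    ∀ᵐ x : Plane,
      IntegrableOn (rieszInnerKernel (coulombW f) x) {y : Plane | ‖y‖ < 1} ∧
      IntegrableOn (rieszOuterKernel (coulombW f) x) {y : Plane | 1 ≤ ‖y‖} := by
  filter_upwards [ae_integrable_rieszKernel f] with x hx
  constructor
  · refine hx.integrableOn.congr_fun (fun y hy => ?_) (measurableSet_lt (by fun_prop) (by fun_prop))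
    simp only [rieszInnerKernel, rieszKernel, if_pos (show ‖y‖ < 1 from hy)]
  · refine hx.integrableOn.congr_fun (fun y hy => ?_) (measurableSet_le (by fun_prop) (by fun_prop))
    simp only [rieszOuterKernel, rieszKernel, if_neg (not_lt.2 (show 1 ≤ ‖y‖ from hy))]

theorem meanFieldPotential_ae_eq :
    meanFieldPotential f =ᵐ[volume]
      fun x => 2 * ∫ y, (rieszKernel x y : ℂ) * coulombW f y := by
  filter_upwards [ae_integrable_rieszKernel f] with x hx
  have hm : MeasurableSet {y : Plane | ‖y‖ < 1} := measurableSet_lt (by fun_prop) (by fun_prop)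
  have hcompl : {y : Plane | 1 ≤ ‖y‖} = {y : Plane | ‖y‖ < 1}ᶜ := by
    ext y
    simp
  have hpi : (Real.pi : ℂ) ≠ 0 := by exact_mod_cast Real.pi_ne_zero
  rw [meanFieldPotential, rieszInner, rieszOuter, ← integral_add_compl hm hx]
  have e1 : ∫ y in {y : Plane | ‖y‖ < 1}, (rieszKernel x y : ℂ) * coulombW f y =
      ∫ y in {y : Plane | ‖y‖ < 1}, rieszInnerKernel (coulombW f) x y :=
    setIntegral_congr_fun hm fun y hy => by
      simp only [rieszInnerKernel, rieszKernel, if_pos (show ‖y‖ < 1 from hy)]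
  have e2 : ∫ y in {y : Plane | ‖y‖ < 1}ᶜ, (rieszKernel x y : ℂ) * coulombW f y =
      ∫ y in {y : Plane | ‖y‖ < 1}ᶜ, rieszOuterKernel (coulombW f) x y :=
    setIntegral_congr_fun hm.compl fun y hy => by
      simp only [rieszOuterKernel, rieszKernel, if_neg (show ¬ ‖y‖ < 1 from hy)]
  rw [e1, e2, hcompl]
  field_simp
  ring

theorem meanFieldPotential_mul_ae_eq (s : Plane → ℂ) :
    (fun x => meanFieldPotential f x * s x) =ᵐ[volume]
      fun x => 2 * ∫ y, (rieszKernel x y : ℂ) * coulombW f y * s x := by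
  filter_upwards [meanFieldPotential_ae_eq f] with x hx
  rw [hx, integral_mul_const, mul_assoc]

variable {s : Plane → ℂ} {C : ℝ}

theorem integrable_meanFieldPotential_mul (hs : AEStronglyMeasurable s)
    (hC : ∀ x, ‖s x‖ ≤ C * ((1 + ‖x‖) ^ 6)⁻¹) :
    Integrable (fun x => meanFieldPotential f x * s x) := by
  rw [integrable_congr (meanFieldPotential_mul_ae_eq f s)]
  exact ((integrable_rieszKernel_mul (Lp.memLp (coulombW f)) hs hC).integral_prod_left).const_mul 2

theorem integral_meanFieldPotential_mul (hs : AEStronglyMeasurable s)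
    (hC : ∀ x, ‖s x‖ ≤ C * ((1 + ‖x‖) ^ 6)⁻¹) :
    ∫ x, meanFieldPotential f x * s x =
      2 * ∫ y, coulombW f y * ∫ x, (rieszKernel x y : ℂ) * s x := by
  rw [integral_congr_ae (meanFieldPotential_mul_ae_eq f s), integral_const_mul,
    integral_integral_swap (integrable_rieszKernel_mul (Lp.memLp (coulombW f)) hs hC)]
  congr 1
  refine integral_congr_ae (Eventually.of_forall fun y => ?_)
  simp only
  rw [← integral_const_mul]
  congr 1
  ext x
  ring

theorem locallyIntegrable_meanFieldPotential : LocallyIntegrable (meanFieldPotential f) := by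
  have h := integrable_meanFieldPotential_mul f (s := fun x => (((1 + ‖x‖) ^ 6)⁻¹ : ℝ)) (C := 1)
    (by apply Measurable.aestronglyMeasurable; fun_prop) fun x => by
      rw [Complex.norm_real, Real.norm_of_nonneg (by positivity), one_mul]
  have h2 := h.locallyIntegrable.mul_continuous (g := fun x : Plane => (((1 + ‖x‖) ^ 6 : ℝ) : ℂ))
    (by fun_prop)
  refine h2.congr (Eventually.of_forall fun x => ?_)
  simp only
  rw [mul_assoc, ← Complex.ofReal_mul, inv_mul_cancel₀ (by positivity)]
  simp

theorem SchwartzMap.exists_norm_le_inv_one_add_norm_pow (s : 𝓢(Plane, ℂ)) :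
    ∃ C, ∀ x, ‖s x‖ ≤ C * ((1 + ‖x‖) ^ 6)⁻¹ := by
  refine ⟨2 ^ 6 * ((Finset.Iic (6, 0)).sup fun m => SchwartzMap.seminorm ℂ m.1 m.2) s,
    fun x => ?_⟩
  rw [← div_eq_mul_inv, le_div_iff₀ (by positivity), mul_comm]
  simpa using SchwartzMap.one_add_le_sup_seminorm_apply (𝕜 := ℂ) (m := (6, 0)) (k := 6) (n := 0)
    le_rfl le_rfl s x

theorem integrable_meanFieldPotential_mul_schwartz (s : 𝓢(Plane, ℂ)) :
    Integrable (fun x => meanFieldPotential f x * s x) := by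
  obtain ⟨C, hC⟩ := s.exists_norm_le_inv_one_add_norm_pow
  exact integrable_meanFieldPotential_mul f s.continuous.aestronglyMeasurable hC

end Potential

/-! ### The Fourier transform of `1/|x|` by Gaussian subordination -/

theorem integral_Ioi_exp_neg_pi_mul_sq {a : ℝ} (ha : 0 ≤ a) :
    ∫ r in Set.Ioi (0 : ℝ), Real.exp (-Real.pi * r ^ 2 * a ^ 2) = 1 / (2 * a) := by
  have e := integral_gaussian_Ioi (Real.pi * a ^ 2)
  rcases ha.eq_or_lt with rfl | ha
  -- At `a = 0` the integral diverges, and both sides take the default value 0.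
  · simp [Measure.real]
  · have h1 : Real.pi / (Real.pi * a ^ 2) = (1 / a) ^ 2 := by field_simp
    rw [h1, Real.sqrt_sq (by positivity)] at e
    rw [show 1 / (2 * a) = 1 / a / 2 by field_simp, ← e]
    congr 1
    ext r
    congr 1
    ring

theorem integrableOn_Ioi_exp_neg_pi_mul_sq {a : ℝ} (ha : 0 < a) :
    IntegrableOn (fun r : ℝ => Real.exp (-Real.pi * r ^ 2 * a ^ 2)) (Set.Ioi 0) := by
  have := (integrable_exp_neg_mul_sq (b := Real.pi * a ^ 2)
    (by positivity)).integrableOn (s := Set.Ioi 0)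
  refine this.congr_fun (fun r _ => ?_) measurableSet_Ioi
  simp only
  congr 1
  ring

theorem gauss_inv_smul_eq {r : ℝ} (hr : 0 < r) (z : Plane) :
    (r ^ 2)⁻¹ * gauss (r⁻¹ • z) = (|(-1 : ℝ)| * r ^ ((-1 : ℝ) - 1)) •
      Real.exp (-Real.pi * (r ^ (-1 : ℝ)) ^ 2 * ‖z‖ ^ 2) := by
  have e1 : r ^ ((-1 : ℝ) - 1) = (r ^ 2)⁻¹ := by
    rw [show ((-1 : ℝ) - 1) = -(2 : ℕ) by norm_num, Real.rpow_neg hr.le, Real.rpow_natCast]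
  rw [e1, Real.rpow_neg_one, abs_neg, abs_one, one_mul, smul_eq_mul, gauss, norm_smul,
    Real.norm_of_nonneg (by positivity)]
  congr 2
  ring

/-- The substitution `r ↦ r⁻¹` reduces this to the preceding Gaussian integral. Thus both `1/|x|`
and its transform are superpositions over the same parameter `r`. -/
theorem integral_Ioi_gauss_inv_smul (z : Plane) :
    ∫ r in Set.Ioi (0 : ℝ), (r ^ 2)⁻¹ * gauss (r⁻¹ • z) = 1 / (2 * ‖z‖) := by
  rw [← integral_Ioi_exp_neg_pi_mul_sq (norm_nonneg z),
    ← integral_comp_rpow_Ioi (fun r : ℝ => Real.exp (-Real.pi * r ^ 2 * ‖z‖ ^ 2)) (by norm_num : (-1 : ℝ) ≠ 0)]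
  exact setIntegral_congr_fun measurableSet_Ioi fun r hr => gauss_inv_smul_eq hr z

theorem integrableOn_Ioi_gauss_inv_smul {z : Plane} (hz : z ≠ 0) :
    IntegrableOn (fun r : ℝ => (r ^ 2)⁻¹ * gauss (r⁻¹ • z)) (Set.Ioi 0) := by
  have := (integrableOn_Ioi_comp_rpow_iff (fun r : ℝ => Real.exp (-Real.pi * r ^ 2 * ‖z‖ ^ 2))
    (by norm_num : (-1 : ℝ) ≠ 0)).2 (integrableOn_Ioi_exp_neg_pi_mul_sq (norm_pos_iff.2 hz))
  exact this.congr_fun (fun r hr => (gauss_inv_smul_eq hr z).symm) measurableSet_Ioi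

/-- Fubini for a nonnegative kernel `p r x` whose integral over `r > 0` is `1 / (2 |x - y|)`. -/
theorem integral_mul_inv_norm_eq_of_kernel {F : Plane → ℂ} {C : ℝ} (hF : Integrable F)
    (hC : ∀ x, ‖F x‖ ≤ C) (y : Plane) {p : ℝ → Plane → ℝ}
    (hp : Measurable (Function.uncurry p)) (hp0 : ∀ r x, 0 ≤ p r x)
    (hpi : ∀ x, x ≠ y → IntegrableOn (fun r => p r x) (Set.Ioi 0))
    (hpe : ∀ x, ∫ r in Set.Ioi (0 : ℝ), p r x = 1 / (2 * ‖x - y‖)) :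
    ∫ x, ((1 / ‖x - y‖ : ℝ) : ℂ) * F x =
      2 * ∫ r in Set.Ioi (0 : ℝ), ∫ x, F x * p r x := by
  have hne : ∀ᵐ x : Plane, x ≠ y := by simp [ae_iff, measure_singleton]
  have hmeas : AEStronglyMeasurable (fun q : ℝ × Plane => F q.2 * p q.1 q.2)
      ((volume.restrict (Set.Ioi (0 : ℝ))).prod (volume : Measure Plane)) :=
    hF.1.comp_snd.mul (Complex.measurable_ofReal.comp hp).aestronglyMeasurable
  have hint : Integrable (fun q : ℝ × Plane => F q.2 * p q.1 q.2)
      ((volume.restrict (Set.Ioi (0 : ℝ))).prod (volume : Measure Plane)) := by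
    rw [integrable_prod_iff' hmeas]
    constructor
    · filter_upwards [hne] with x hx
      exact Integrable.const_mul (hpi x hx).ofReal (F x)
    · refine ((integrable_inv_norm_mul hF hC y).norm.const_mul (1 / 2)).congr
        (Eventually.of_forall fun x => ?_)
      simp only [norm_mul, Complex.norm_real, Real.norm_of_nonneg (hp0 _ x)]
      rw [integral_const_mul, hpe, Real.norm_of_nonneg (by positivity)]
      ring
  rw [integral_integral_swap hint, ← integral_const_mul]
  refine integral_congr_ae (Eventually.of_forall fun x => ?_)
  simp only
  rw [integral_const_mul, integral_complex_ofReal, hpe]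
  by_cases h : (‖x - y‖ : ℂ) = 0
  · simp [h]
  · push_cast
    field_simp

theorem integrable_rieszSymbol {s : Plane → ℂ} (hs' : Integrable (𝓕 s)) :
    Integrable (rieszSymbol s) := by
  have := (integrable_inv_norm_mul hs' (norm_fourier_le s) 0).const_mul (1 / (2 * Real.pi) : ℂ)
  refine this.congr (Eventually.of_forall fun ξ => ?_)
  simp only [rieszSymbol, sub_zero]
  push_cast
  by_cases h : (‖ξ‖ : ℂ) = 0
  · simp [h]
  · have hpi : (Real.pi : ℂ) ≠ 0 := by exact_mod_cast Real.pi_ne_zero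
    field_simp

/-- The kernel `1 / |x|` is its own Fourier transform in the plane. -/
theorem integral_inv_norm_mul_eq_fourierInv {s : Plane → ℂ} {C : ℝ} (hs : Integrable s)
    (hC : ∀ x, ‖s x‖ ≤ C) (hs' : Integrable (𝓕 s)) (y : Plane) :
    ∫ x, ((1 / ‖x - y‖ : ℝ) : ℂ) * s x = 2 * Real.pi * 𝓕⁻ (rieszSymbol s) y := by
  have hgm : Measurable gauss := continuous_gauss.measurable
  rw [integral_mul_inv_norm_eq_of_kernel hs hC y
    (p := fun r x => (r ^ 2)⁻¹ * gauss (r⁻¹ • (y - x))) (by unfold Function.uncurry; fun_prop)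
    (fun r x => mul_nonneg (by positivity) (gauss_pos _).le)
    (fun x hx => integrableOn_Ioi_gauss_inv_smul (sub_ne_zero.2 hx.symm))
    (fun x => by rw [integral_Ioi_gauss_inv_smul, norm_sub_rev])]
  set F : Plane → ℂ := fun ξ =>
    Complex.exp (((2 * Real.pi * inner ℝ ξ y : ℝ) : ℂ) * Complex.I) * 𝓕 s ξ with hF
  have hFn : ∀ ξ, ‖F ξ‖ = ‖𝓕 s ξ‖ := fun ξ => by
    rw [hF, norm_mul, Complex.norm_exp_ofReal_mul_I, one_mul]
  have hFi : Integrable F := by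
    refine hs'.bdd_mul (c := 1) (by apply Continuous.aestronglyMeasurable; fun_prop)
        (Eventually.of_forall fun ξ => by rw [Complex.norm_exp_ofReal_mul_I])
  have h2 := integral_mul_inv_norm_eq_of_kernel hFi
    (fun ξ => (hFn ξ).trans_le (norm_fourier_le s ξ)) 0
    (p := fun r ξ => Real.exp (-Real.pi * r ^ 2 * ‖ξ‖ ^ 2)) (by unfold Function.uncurry; fun_prop)
    (fun r x => (Real.exp_pos _).le)
    (fun ξ hξ => integrableOn_Ioi_exp_neg_pi_mul_sq (norm_pos_iff.2 hξ))
    (fun ξ => by rw [integral_Ioi_exp_neg_pi_mul_sq (norm_nonneg _), sub_zero])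
  have h3 : 2 * Real.pi * 𝓕⁻ (rieszSymbol s) y = ∫ ξ, ((1 / ‖ξ - 0‖ : ℝ) : ℂ) * F ξ := by
    rw [Real.fourierInv_eq', ← integral_const_mul]
    refine integral_congr_ae (Eventually.of_forall fun ξ => ?_)
    simp only [hF, rieszSymbol, sub_zero, smul_eq_mul]
    generalize Complex.exp (((2 * Real.pi * inner ℝ ξ y : ℝ) : ℂ) * Complex.I) = E
    push_cast
    by_cases h : (‖ξ‖ : ℂ) = 0
    · simp [h]
    · have hpi : (Real.pi : ℂ) ≠ 0 := by exact_mod_cast Real.pi_ne_zero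
      field_simp
  rw [h3, h2]
  congr 1
  -- For fixed `r` both inner integrals are the Gaussian average of `s` at `y`, written once in
  -- space and once in frequency.
  refine setIntegral_congr_fun measurableSet_Ioi fun r hr => ?_
  have e1 := heat_eq_integral hr s y
  have e2 := heat_eq_fourierInv hr hs y
  rw [e1, Real.fourierInv_eq'] at e2
  simp only [Complex.ofReal_mul] at e2 ⊢
  rw [e2]
  refine integral_congr_ae (Eventually.of_forall fun ξ => ?_)
  simp only [hF, smul_eq_mul, Complex.ofReal_mul]
  ring

/-- The two kernels differ by a function of `y` alone, which integrates to zero against a mean-zero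
`s`. -/
theorem integral_rieszKernel_mul {s : Plane → ℂ} {C : ℝ} (hs : Integrable s)
    (hC : ∀ x, ‖s x‖ ≤ C) (h0 : ∫ x, s x = 0) (y : Plane) :
    ∫ x, (rieszKernel x y : ℂ) * s x = ∫ x, ((1 / ‖x - y‖ : ℝ) : ℂ) * s x := by
  by_cases hy : ‖y‖ < 1
  · simp only [rieszKernel, if_pos hy]
  · simp only [rieszKernel, if_neg hy, Complex.ofReal_sub, sub_mul]
    rw [integral_sub (integrable_inv_norm_mul hs hC y) (hs.const_mul _), integral_const_mul, h0]
    simp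

/-- The identity `𝒟(f, s) = ∫ V_f s` for Schwartz functions `s` of finite Coulomb energy. -/
theorem integral_meanFieldPotential_mul_schwartz {f : Plane → ℂ} (hf : f ∈ coulombSpace)
    (hreal : ∀ᵐ x, (f x).im = 0) (s : 𝓢(Plane, ℂ)) (hs : MemLp (rieszSymbol s) 2) :
    ∫ x, meanFieldPotential f x * s x = hartree f s := by
  obtain ⟨C, hC⟩ := s.exists_norm_le_inv_one_add_norm_pow
  have hC0 : 0 ≤ C := by simpa using (norm_nonneg _).trans (hC 0)
  have hC' : ∀ x, ‖s x‖ ≤ C := fun x => (hC x).trans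
    (mul_le_of_le_one_right hC0 (inv_le_one_of_one_le₀
      (one_le_pow₀ (by linarith [norm_nonneg x]))))
  have hs' : Integrable (𝓕 (s : Plane → ℂ)) := by
    rw [← SchwartzMap.fourier_coe]
    exact (𝓕 s).integrable
  rw [integral_meanFieldPotential_mul f s.continuous.aestronglyMeasurable hC]
  simp only [integral_rieszKernel_mul s.integrable hC'
    (integral_eq_zero_of_memLp_rieszSymbol s.integrable hs),
    integral_inv_norm_mul_eq_fourierInv s.integrable hC' hs']
  have e : ∀ y, coulombW f y * (2 * Real.pi * 𝓕⁻ (rieszSymbol s) y) =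
      2 * Real.pi * (coulombW f y * 𝓕⁻ (rieszSymbol s) y) := fun y => by ring
  simp only [e]
  rw [integral_const_mul, coulombW_eq hf,
    integral_fourierInv_mul_fourierInv _ (integrable_rieszSymbol hs') hs, hartree_eq,
    ← integral_neg_eq_self]
  rw [← mul_assoc, ← mul_assoc]
  congr 1
  · norm_num
  -- Parseval leaves the symbol of `f` at `-ξ`; since `f` is real, this is the conjugate required by
  -- `𝒟`.
  · have := (Measure.measurePreserving_neg (volume : Measure Plane)).quasiMeasurePreserving.ae_eq_comp
      (memLp_rieszSymbol hf).coeFn_toLp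
    refine integral_congr_ae ?_
    filter_upwards [this] with ξ hξ
    simp only [Function.comp_apply] at hξ
    rw [hξ, rieszSymbol_neg_of_real hreal, neg_neg]

/-! ### Difference quotients of the potential -/

theorem integrable_exp_mul {h : Plane → ℂ} (hh : Integrable h) (ξ : Plane) :
    Integrable (fun x : Plane =>
      Complex.exp (((-2 * Real.pi * inner ℝ x ξ : ℝ) : ℂ) * Complex.I) • h x) :=
  hh.bdd_mul (c := 1) (by apply Continuous.aestronglyMeasurable; fun_prop)
    (Eventually.of_forall fun x => by rw [Complex.norm_exp_ofReal_mul_I])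

theorem fourier_sub_apply {f g : Plane → ℂ} (hf : Integrable f) (hg : Integrable g) (ξ : Plane) :
    𝓕 (fun x => f x - g x) ξ = 𝓕 f ξ - 𝓕 g ξ := by
  simp only [Real.fourier_eq']
  rw [← integral_sub (integrable_exp_mul hf ξ) (integrable_exp_mul hg ξ)]
  simp only [smul_sub]

theorem rieszSymbol_sub {f g : Plane → ℂ} (hf : Integrable f) (hg : Integrable g) (ξ : Plane) :
    rieszSymbol (fun x => f x - g x) ξ = rieszSymbol f ξ - rieszSymbol g ξ := by
  rw [rieszSymbol, fourier_sub_apply hf hg, sub_div, rieszSymbol, rieszSymbol]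

theorem fourier_translate (s : Plane → ℂ) (c ξ : Plane) :
    𝓕 (fun x => s (x + c)) ξ =
      Complex.exp (Complex.I * ((-2 * Real.pi * inner ℝ (-ξ) c : ℝ) : ℂ)) * 𝓕 s ξ := by
  simp only [Real.fourier_eq']
  rw [← integral_sub_right_eq_self _ c, ← integral_const_mul]
  refine integral_congr_ae (Eventually.of_forall fun x => ?_)
  simp only [smul_eq_mul, sub_add_cancel]
  rw [← mul_assoc, ← Complex.exp_add]
  congr 2
  rw [inner_sub_left, inner_neg_left, real_inner_comm c ξ]
  push_cast
  ring

theorem aestronglyMeasurable_rieszSymbol {h : Plane → ℂ} (hh : Integrable h) :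
    AEStronglyMeasurable (rieszSymbol h) := by
  have := (continuous_fourier hh).measurable
  unfold rieszSymbol
  apply Measurable.aestronglyMeasurable
  fun_prop

/-- The Fourier multiplier of the difference `h ↦ h - h (· - c)`. -/
noncomputable def differenceSymbol (c ξ : Plane) : ℂ :=
  1 - Complex.exp (Complex.I * ((-2 * Real.pi * inner ℝ ξ c : ℝ) : ℂ))

theorem norm_differenceSymbol_le (c ξ : Plane) :
    ‖differenceSymbol c ξ‖ ≤ ‖c‖ * (2 * Real.pi * ‖ξ‖) := by
  rw [differenceSymbol, norm_sub_rev]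
  refine Real.norm_exp_I_mul_ofReal_sub_one_le.trans ?_
  rw [norm_mul, norm_mul, norm_neg, Real.norm_ofNat, Real.norm_of_nonneg Real.pi_pos.le]
  calc _ ≤ 2 * Real.pi * (‖ξ‖ * ‖c‖) := by
        gcongr
        exact norm_inner_le_norm _ _
    _ = _ := by ring

theorem continuous_differenceSymbol (c : Plane) : Continuous (differenceSymbol c) := by
  unfold differenceSymbol
  fun_prop

/-- The zero of the difference multiplier at the origin compensates the singularity `1/|ξ|`. At `ξ =
0` the quotient is 0 by convention, so no exception is needed. -/
theorem norm_differenceSymbol_mul_div_le (c ξ : Plane) (z : ℂ) :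
    ‖differenceSymbol c ξ * z / ((2 * Real.pi * ‖ξ‖ : ℝ) : ℂ)‖ ≤ ‖c‖ * ‖z‖ := by
  rw [norm_div, norm_mul, Complex.norm_real,
    Real.norm_of_nonneg (by positivity)]
  refine div_le_of_le_mul₀ (by positivity) (by positivity) ?_
  calc _ ≤ (‖c‖ * (2 * Real.pi * ‖ξ‖)) * ‖z‖ := by
        gcongr
        exact norm_differenceSymbol_le c ξ
    _ = _ := by ring

theorem rieszSymbol_sub_translate {s : Plane → ℂ} (hs : Integrable s) (c ξ : Plane) :
    rieszSymbol (fun x => s x - s (x + c)) ξ =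
      differenceSymbol c (-ξ) * 𝓕 s ξ / ((2 * Real.pi * ‖ξ‖ : ℝ) : ℂ) := by
  rw [rieszSymbol, fourier_sub_apply hs (hs.comp_add_right c), fourier_translate, differenceSymbol]
  ring

section Difference

variable {f : Plane → ℂ}

theorem locallyIntegrable_meanFieldPotential_translate (f : Plane → ℂ) (c : Plane) :
    LocallyIntegrable (fun x => meanFieldPotential f (x - c)) := by
  have h := integrable_meanFieldPotential_mul f (s := fun x => (((1 + ‖x‖) ^ 6)⁻¹ : ℝ)) (C := 1)
    (by apply Measurable.aestronglyMeasurable; fun_prop) fun x => by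
      rw [Complex.norm_real, Real.norm_of_nonneg (by positivity), one_mul]
  have h2 := (h.comp_sub_right c).locallyIntegrable.mul_continuous
    (g := fun x : Plane => (((1 + ‖x - c‖) ^ 6 : ℝ) : ℂ)) (by fun_prop)
  refine h2.congr (Eventually.of_forall fun x => ?_)
  simp only
  rw [mul_assoc, ← Complex.ofReal_mul, inv_mul_cancel₀ (by positivity)]
  simp

theorem HasCompactSupport.comp_add_right {s : Plane → ℂ} (hs : HasCompactSupport s) (c : Plane) :
    HasCompactSupport (fun x => s (x + c)) :=
  hs.comp_homeomorph (Homeomorph.addRight c)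

/-- The difference quotients of the mean-field potential, on the Fourier side. -/
theorem meanFieldPotential_sub_translate_ae_eq (hf : f ∈ coulombSpace)
    (hreal : ∀ᵐ x, (f x).im = 0) (c : Plane)
    (hG : MemLp (fun ξ => differenceSymbol c ξ * rieszSymbol f ξ /
      ((2 * Real.pi * ‖ξ‖ : ℝ) : ℂ)) 2) :
    (fun x => meanFieldPotential f x - meanFieldPotential f (x - c)) =ᵐ[volume]
      fun x => 4 * (Real.pi : ℂ) * (𝓕⁻ (hG.toLp _) : Lp ℂ 2 (volume : Measure Plane)) x := by
  refine ae_eq_of_integral_contDiff_smul_eq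
    ((locallyIntegrable_meanFieldPotential f).sub
      (locallyIntegrable_meanFieldPotential_translate f c))
    (((Lp.memLp _).locallyIntegrable (by norm_num)).smul (4 * (Real.pi : ℂ))) ?_
  intro g hg hgc
  have hsc : HasCompactSupport (fun x => (g x : ℂ)) :=
    hgc.comp_left (g := fun r : ℝ => (r : ℂ)) (by simp)
  have hsd : ContDiff ℝ ∞ (fun x => (g x : ℂ)) := Complex.ofRealCLM.contDiff.comp hg
  set s : 𝓢(Plane, ℂ) := hsc.toSchwartzMap hsd with hs
  have hsg : ∀ x, s x = g x := fun x => rfl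
  -- The test function `s` itself may have infinite energy, but its difference `t` always has finite
  -- energy, so the Schwartz identity applies after the translation is moved from `V_f` to `s`.
  set t : 𝓢(Plane, ℂ) := (HasCompactSupport.sub hsc (hsc.comp_add_right c)).toSchwartzMap
    (hsd.sub (hsd.comp (contDiff_id.add contDiff_const)))
  have hts : (t : Plane → ℂ) = fun x => s x - s (x + c) := rfl
  have htW : ∀ ξ, rieszSymbol t ξ =
      differenceSymbol c (-ξ) * 𝓕 (s : Plane → ℂ) ξ / ((2 * Real.pi * ‖ξ‖ : ℝ) : ℂ) := by
    intro ξ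
    rw [hts, rieszSymbol_sub_translate s.integrable]
  have htL : MemLp (rieszSymbol t) 2 := by
    have h1 : MemLp (𝓕 (s : Plane → ℂ)) 2 := by
      rw [← SchwartzMap.fourier_coe]
      exact (𝓕 s).memLp 2
    refine h1.of_le_mul (c := ‖c‖) (aestronglyMeasurable_rieszSymbol t.integrable)
      (Eventually.of_forall fun ξ => ?_)
    rw [htW]
    simpa using norm_differenceSymbol_mul_div_le c (-ξ) (𝓕 (s : Plane → ℂ) ξ)
  have key := integral_meanFieldPotential_mul_schwartz hf hreal t htL
  have i1 := integrable_meanFieldPotential_mul_schwartz f s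
  set s' : 𝓢(Plane, ℂ) := (hsc.comp_add_right c).toSchwartzMap
    (hsd.comp (contDiff_id.add contDiff_const))
  have i2 : Integrable (fun x => meanFieldPotential f x * s (x + c)) :=
    integrable_meanFieldPotential_mul_schwartz f s'
  have i3 : Integrable (fun x => meanFieldPotential f (x - c) * s x) := by
    simpa using i2.comp_sub_right c
  have e1 : ∫ x, g x • (meanFieldPotential f x - meanFieldPotential f (x - c)) =
      ∫ x, meanFieldPotential f x * t x := by
    have a1 : ∀ x, g x • (meanFieldPotential f x - meanFieldPotential f (x - c)) =
        meanFieldPotential f x * s x - meanFieldPotential f (x - c) * s x := by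
      intro x
      rw [Complex.real_smul, hsg]
      ring
    have a2 : ∀ x, meanFieldPotential f x * t x =
        meanFieldPotential f x * s x - meanFieldPotential f x * s (x + c) := by
      intro x
      rw [hts, mul_sub]
    simp only [a1, a2]
    rw [integral_sub i1 i3, integral_sub i1 i2,
      ← integral_sub_right_eq_self (fun x => meanFieldPotential f x * s (x + c)) c]
    simp only [sub_add_cancel]
  have e2 : ∫ x, g x • (4 * (Real.pi : ℂ) *
      (𝓕⁻ (hG.toLp _) : Lp ℂ 2 (volume : Measure Plane)) x) =
      4 * (Real.pi : ℂ) *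
        ∫ x, (𝓕⁻ (hG.toLp _) : Lp ℂ 2 (volume : Measure Plane)) x * s x := by
    rw [← integral_const_mul]
    congr 1
    ext x
    rw [Complex.real_smul, hsg]
    ring
  rw [e1, e2, key, hartree_eq, integral_fourierInv_Lp_mul]
  congr 1
  have := (Measure.measurePreserving_neg (volume : Measure Plane)).quasiMeasurePreserving.ae_eq_comp
    hG.coeFn_toLp
  rw [← integral_neg_eq_self (fun ξ => (hG.toLp _ : Plane → ℂ) ξ * 𝓕⁻ (s : Plane → ℂ) ξ)]
  refine integral_congr_ae ?_
  filter_upwards [this] with ξ hξ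
  simp only [Function.comp_apply] at hξ
  rw [hξ, rieszSymbol_neg_of_real hreal, htW, Real.fourierInv_eq_fourier_neg, norm_neg, neg_neg]
  ring

/-- Plancherel applied to the Fourier description of the difference. This is a derivative-free form
of `‖∇V_f‖ ≤ 4π ‖W_f‖` in `L²`. -/
theorem eLpNorm_meanFieldPotential_sub_translate_le (hf : f ∈ coulombSpace)
    (hreal : ∀ᵐ x, (f x).im = 0) (c : Plane) :
    eLpNorm (fun x => meanFieldPotential f x - meanFieldPotential f (x - c)) 2 ≤
      ENNReal.ofReal ((4 * Real.pi * (eLpNorm (rieszSymbol f) 2).toReal) * ‖c‖) := by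
  have hW := memLp_rieszSymbol hf
  have hb : ∀ᵐ ξ, ‖differenceSymbol c ξ * rieszSymbol f ξ / ((2 * Real.pi * ‖ξ‖ : ℝ) : ℂ)‖ ≤
      ‖c‖ * ‖rieszSymbol f ξ‖ :=
    Eventually.of_forall fun ξ => norm_differenceSymbol_mul_div_le c ξ _
  have hG : MemLp (fun ξ => differenceSymbol c ξ * rieszSymbol f ξ /
      ((2 * Real.pi * ‖ξ‖ : ℝ) : ℂ)) 2 := by
    refine hW.of_le_mul ?_ hb
    simp only [div_eq_mul_inv]
    exact ((continuous_differenceSymbol c).aestronglyMeasurable.mul hW.1).mul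
      (by apply Measurable.aestronglyMeasurable; fun_prop)
  rw [eLpNorm_congr_ae (meanFieldPotential_sub_translate_ae_eq hf hreal c hG)]
  have h1 := eLpNorm_le_mul_eLpNorm_of_ae_le_mul hb 2
  rw [← eLpNorm_congr_ae hG.coeFn_toLp] at h1
  have h2 : eLpNorm (𝓕⁻ (hG.toLp _) : Lp ℂ 2 (volume : Measure Plane)) 2 volume =
      eLpNorm (hG.toLp _) 2 volume := by
    have := Lp.norm_fourierInv_eq (hG.toLp _)
    rwa [Lp.norm_def, Lp.norm_def, ENNReal.toReal_eq_toReal_iff' (Lp.eLpNorm_ne_top _)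
      (Lp.eLpNorm_ne_top _)] at this
  refine (eLpNorm_const_smul_le (c := 4 * (Real.pi : ℂ))
    (f := (𝓕⁻ (hG.toLp _) : Lp ℂ 2 (volume : Measure Plane)))).trans ?_
  rw [h2]
  have h3 : ‖4 * (Real.pi : ℂ)‖ₑ = ENNReal.ofReal (4 * Real.pi) := by
    rw [← ofReal_norm]
    congr 1
    simp [abs_of_pos Real.pi_pos]
  rw [h3]
  calc _ ≤ ENNReal.ofReal (4 * Real.pi) * (ENNReal.ofReal ‖c‖ * eLpNorm (rieszSymbol f) 2) := by
        gcongr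
    _ = _ := by
        rw [← ENNReal.ofReal_toReal hW.eLpNorm_ne_top, ← ENNReal.ofReal_mul (by positivity),
          ← ENNReal.ofReal_mul (by positivity), ENNReal.toReal_ofReal ENNReal.toReal_nonneg]
        congr 1
        ring

end Difference

/-! ### Density of Schwartz functions -/

theorem rieszSymbol_add {f g : Plane → ℂ} (hf : Integrable f) (hg : Integrable g) (ξ : Plane) :
    rieszSymbol (fun x => f x + g x) ξ = rieszSymbol f ξ + rieszSymbol g ξ := by
  simp only [rieszSymbol, Real.fourier_eq', smul_add]
  rw [integral_add (integrable_exp_mul hf ξ) (integrable_exp_mul hg ξ), add_div]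

theorem rieszSymbol_const_mul (a : ℂ) (f : Plane → ℂ) (ξ : Plane) :
    rieszSymbol (fun x => a * f x) ξ = a * rieszSymbol f ξ := by
  simp only [rieszSymbol, Real.fourier_eq', smul_eq_mul, mul_left_comm _ a]
  rw [integral_const_mul, mul_div_assoc]

/-- The classes in `L²` of the symbols of Schwartz functions. -/
noncomputable def schwartzSymbols : Submodule ℂ (Lp ℂ 2 (volume : Measure Plane)) where
  carrier := {k | ∃ s : 𝓢(Plane, ℂ), k =ᵐ[volume] rieszSymbol s}
  add_mem' := by
    rintro a b ⟨s, hs⟩ ⟨t, ht⟩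
    refine ⟨s + t, ?_⟩
    filter_upwards [hs, ht, Lp.coeFn_add a b] with ξ h1 h2 h3
    rw [h3, Pi.add_apply, h1, h2]
    exact (rieszSymbol_add s.integrable t.integrable ξ).symm
  zero_mem' := by
    refine ⟨0, ?_⟩
    filter_upwards [Lp.coeFn_zero ℂ 2 (volume : Measure Plane)] with ξ h
    rw [h]
    have := (rieszSymbol_const_mul 0 0 ξ).symm
    simp only [zero_mul] at this
    exact this
  smul_mem' := by
    rintro a k ⟨s, hs⟩
    refine ⟨a • s, ?_⟩
    filter_upwards [hs, Lp.coeFn_smul a k] with ξ h1 h2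
    rw [h2, Pi.smul_apply, h1]
    exact (rieszSymbol_const_mul a s ξ).symm

/-- The class contains `|ξ| g / (2π)` for every real test function `g`. Orthogonality to these
forces `|ξ| G = 0`, hence `G = 0` almost everywhere. -/
theorem schwartzSymbols_orthogonal : schwartzSymbolsᗮ = ⊥ := by
  rw [Submodule.eq_bot_iff]
  intro G hG
  rw [Submodule.mem_orthogonal] at hG
  have hpi : (Real.pi : ℂ) ≠ 0 := by exact_mod_cast Real.pi_ne_zero
  have hGl : LocallyIntegrable (fun ξ => (‖ξ‖ : ℂ) * G ξ) :=
    ((Lp.memLp G).locallyIntegrable (by norm_num)).continuous_mul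
      (by fun_prop : Continuous fun ξ : Plane => (‖ξ‖ : ℂ))
  have hzero : ∀ᵐ ξ, (‖ξ‖ : ℂ) * G ξ = 0 := by
    refine ae_eq_zero_of_integral_contDiff_smul_eq_zero hGl ?_
    intro g hg hgc
    -- The square `|ξ|²` keeps the Fourier transform smooth at the origin; forming the symbol
    -- removes one power.
    have hcd : ContDiff ℝ ∞ (fun ξ : Plane => ((‖ξ‖ ^ 2 * g ξ : ℝ) : ℂ)) :=
      Complex.ofRealCLM.contDiff.comp ((contDiff_norm_sq ℝ).mul hg)
    have hcs : HasCompactSupport (fun ξ : Plane => ((‖ξ‖ ^ 2 * g ξ : ℝ) : ℂ)) :=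
      (hgc.mul_left (f := fun ξ : Plane => ‖ξ‖ ^ 2)).comp_left (g := fun r : ℝ => (r : ℂ)) (by simp)
    set χ : 𝓢(Plane, ℂ) := hcs.toSchwartzMap hcd
    have hχ : ∀ ξ, χ ξ = ((‖ξ‖ ^ 2 * g ξ : ℝ) : ℂ) := fun ξ => rfl
    have hF : 𝓕 ((𝓕⁻ χ : 𝓢(Plane, ℂ)) : Plane → ℂ) = χ := by
      rw [← SchwartzMap.fourier_coe, FourierTransform.fourier_fourierInv_eq]
    set k : Plane → ℂ := fun ξ => ((‖ξ‖ * g ξ / (2 * Real.pi) : ℝ) : ℂ) with hk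
    have hsym : ∀ ξ, rieszSymbol (𝓕⁻ χ : 𝓢(Plane, ℂ)) ξ = k ξ := by
      intro ξ
      rw [rieszSymbol, hF, hχ, hk]
      by_cases h : (‖ξ‖ : ℂ) = 0
      · simp [h]
      · push_cast
        field_simp
    have hkL : MemLp k 2 := by
      have hkc : Continuous k := by
        have := hg.continuous
        fun_prop
      refine hkc.memLp_of_hasCompactSupport ?_
      exact ((hgc.mul_left (f := fun ξ : Plane => ‖ξ‖)).comp_left
        (g := fun r : ℝ => ((r / (2 * Real.pi) : ℝ) : ℂ)) (by simp))
    have h1 := hG (hkL.toLp k) ⟨𝓕⁻ χ, by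
      filter_upwards [hkL.coeFn_toLp] with ξ h
      rw [h, hsym]⟩
    rw [L2.inner_def] at h1
    have h2 : ∫ ξ, g ξ • ((‖ξ‖ : ℂ) * G ξ) =
        2 * Real.pi * ∫ ξ, inner ℂ ((hkL.toLp k) ξ) (G ξ) := by
      rw [← integral_const_mul]
      refine integral_congr_ae ?_
      filter_upwards [hkL.coeFn_toLp] with ξ h
      rw [h, RCLike.inner_apply, hk, Complex.real_smul, Complex.conj_ofReal]
      push_cast
      field_simp
    rw [h2, h1, mul_zero]
  rw [Lp.eq_zero_iff_ae_eq_zero]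
  have hne : ∀ᵐ ξ : Plane, ξ ≠ 0 := by simp [ae_iff, measure_singleton]
  filter_upwards [hzero, hne] with ξ h1 h2
  have : (‖ξ‖ : ℂ) ≠ 0 := by simpa using h2
  simpa [this] using h1

/-- Approximation is in Coulomb norm only, with no closeness in `L¹`. This suffices because the
bounds on both pairings involve only the `L²` norm of the symbol. -/
theorem exists_schwartz_eLpNorm_rieszSymbol_sub_lt {h : Plane → ℂ} (hh : Integrable h)
    (hW : MemLp (rieszSymbol h) 2) {ε : ℝ} (hε : 0 < ε) :
    ∃ s : 𝓢(Plane, ℂ), MemLp (rieszSymbol s) 2 ∧ MemLp (rieszSymbol fun x => h x - s x) 2 ∧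
      (eLpNorm (rieszSymbol fun x => h x - s x) 2).toReal < ε := by
  have hd := (Submodule.topologicalClosure_eq_top_iff (K := schwartzSymbols)).2
    schwartzSymbols_orthogonal
  have hmem : hW.toLp _ ∈ closure (schwartzSymbols : Set (Lp ℂ 2 (volume : Measure Plane))) := by
    rw [← Submodule.topologicalClosure_coe, hd]
    trivial
  obtain ⟨k, ⟨s, hs⟩, hk⟩ := Metric.mem_closure_iff.1 hmem ε hε
  have hsL : MemLp (rieszSymbol s) 2 := (memLp_congr_ae hs).1 (Lp.memLp k)
  have e : (⇑(hW.toLp _ - k) : Plane → ℂ) =ᵐ[volume] rieszSymbol fun x => h x - s x := by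
    filter_upwards [Lp.coeFn_sub (hW.toLp _) k, hW.coeFn_toLp, hs] with ξ h1 h2 h3
    rw [h1, Pi.sub_apply, h2, h3, rieszSymbol_sub hh s.integrable]
  refine ⟨s, hsL, (memLp_congr_ae e).1 (Lp.memLp _), ?_⟩
  rw [← eLpNorm_congr_ae e, ← Lp.norm_def, ← dist_eq_norm]
  exact hk

/-! ### Truncation -/

theorem norm_truncateAt_le {M : ℝ} (hM : 0 < M) (z : ℂ) : ‖truncateAt M z‖ ≤ M := by
  have h : 0 < max M ‖z‖ := lt_max_of_lt_left hM
  rw [truncateAt, norm_mul, Complex.norm_real, Real.norm_of_nonneg (by positivity),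
    div_mul_eq_mul_div, div_le_iff₀ h]
  exact mul_le_mul_of_nonneg_left (le_max_right _ _) hM.le

theorem norm_truncateAt_le_norm {M : ℝ} (hM : 0 < M) (z : ℂ) : ‖truncateAt M z‖ ≤ ‖z‖ := by
  have h : 0 < max M ‖z‖ := lt_max_of_lt_left hM
  rw [truncateAt, norm_mul, Complex.norm_real, Real.norm_of_nonneg (by positivity)]
  exact mul_le_of_le_one_left (norm_nonneg _) ((div_le_one h).2 (le_max_left _ _))

theorem truncateAt_of_norm_le {M : ℝ} (hM : 0 < M) {z : ℂ} (hz : ‖z‖ ≤ M) :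
    truncateAt M z = z := by
  rw [truncateAt, max_eq_left hz, div_self hM.ne']
  simp

theorem continuous_truncateAt {M : ℝ} (hM : 0 < M) : Continuous (truncateAt M) := by
  unfold truncateAt
  have : Continuous fun z : ℂ => M / max M ‖z‖ :=
    continuous_const.div (by fun_prop) fun z => (lt_max_of_lt_left hM).ne'
  fun_prop

/-- The radial factor and the vector are varied separately, at a cost of `‖z - w‖` each. The
constant 2 is not optimal; what matters is that it does not depend on `M`. -/
theorem norm_truncateAt_sub_le {M : ℝ} (hM : 0 < M) (z w : ℂ) :
    ‖truncateAt M z - truncateAt M w‖ ≤ 2 * ‖z - w‖ := by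
  set a := max M ‖z‖ with ha
  set b := max M ‖w‖ with hb
  have ha0 : 0 < a := lt_max_of_lt_left hM
  have hb0 : 0 < b := lt_max_of_lt_left hM
  have e : truncateAt M z - truncateAt M w =
      ((M / a : ℝ) : ℂ) * (z - w) + ((M / a - M / b : ℝ) : ℂ) * w := by
    simp only [truncateAt, ← ha, ← hb]
    push_cast
    ring
  have h1 : |M / a - M / b| * ‖w‖ ≤ ‖z - w‖ := by
    have h2 : M / a - M / b = (M / a) * ((b - a) / b) := by field_simp
    have h3 : |b - a| ≤ ‖z - w‖ := by
      rw [abs_sub_comm]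
      have := (abs_max_sub_max_le_abs ‖z‖ ‖w‖ M).trans (abs_norm_sub_norm_le z w)
      rwa [max_comm, max_comm ‖w‖] at this
    rw [h2, abs_mul, abs_div (b - a), abs_of_pos hb0, abs_of_pos (by positivity : 0 < M / a)]
    calc M / a * (|b - a| / b) * ‖w‖ ≤ 1 * (|b - a| / b) * b := by
          gcongr
          · exact (div_le_one ha0).2 (le_max_left _ _)
          · exact le_max_right _ _
      _ = |b - a| := by field_simp
      _ ≤ _ := h3
  rw [e]
  refine (norm_add_le _ _).trans ?_
  rw [norm_mul, norm_mul, Complex.norm_real, Complex.norm_real, Real.norm_eq_abs, Real.norm_eq_abs,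
    abs_of_pos (by positivity : 0 < M / a)]
  have h4 : M / a * ‖z - w‖ ≤ ‖z - w‖ :=
    mul_le_of_le_one_left (norm_nonneg _) ((div_le_one ha0).2 (le_max_left _ _))
  linarith

theorem hasTruncatedIntegral_of_integrable {V h : Plane → ℂ} (hV : AEStronglyMeasurable V)
    (hh : AEStronglyMeasurable h) (hi : Integrable fun x => V x * h x) :
    HasTruncatedIntegral V h (∫ x, V x * h x) := by
  refine tendsto_integral_filter_of_dominated_convergence (fun x => ‖V x * h x‖) ?_ ?_ hi.norm ?_
  · filter_upwards [eventually_gt_atTop 0] with M hM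
    exact ((continuous_truncateAt hM).comp_aestronglyMeasurable hV).mul hh
  · filter_upwards [eventually_gt_atTop 0] with M hM
    refine Eventually.of_forall fun x => ?_
    rw [norm_mul, norm_mul]
    gcongr
    exact norm_truncateAt_le_norm hM _
  · refine Eventually.of_forall fun x => tendsto_const_nhds.congr' ?_
    filter_upwards [eventually_gt_atTop 0, eventually_ge_atTop ‖V x‖] with M hM hx
    rw [truncateAt_of_norm_le hM hx]

/-! ### Passage to general `h`, and the distributional equation -/

section Main

variable {f : Plane → ℂ}

/-- Truncation makes the potential bounded while doubling its difference bound at most. The height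
`M` is absent from the right-hand side, which permits approximating `h` before letting `M` tend to
infinity. -/
theorem norm_integral_truncateAt_mul_le (hf : f ∈ coulombSpace) (hreal : ∀ᵐ x, (f x).im = 0)
    {M : ℝ} (hM : 0 < M) {h : Plane → ℂ} (hh : Integrable h) (hW : MemLp (rieszSymbol h) 2) :
    ‖∫ x, truncateAt M (meanFieldPotential f x) * h x‖ ≤
      (2 * (4 * Real.pi * (eLpNorm (rieszSymbol f) 2).toReal)) *
        (eLpNorm (rieszSymbol h) 2).toReal * (2 * Real.pi * ∫ b, gauss b * ‖b‖ ^ 2) := by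
  have hV := (locallyIntegrable_meanFieldPotential f).aestronglyMeasurable
  refine norm_integral_mul_le_of_difference (M := M) (by positivity)
    ((continuous_truncateAt hM).comp_aestronglyMeasurable hV)
    (fun x => norm_truncateAt_le hM _) (fun c => ?_) hh hW
  have h1 : eLpNorm (fun x => truncateAt M (meanFieldPotential f x) -
      truncateAt M (meanFieldPotential f (x - c))) 2 ≤ ENNReal.ofReal 2 *
      eLpNorm (fun x => meanFieldPotential f x - meanFieldPotential f (x - c)) 2 :=
    eLpNorm_le_mul_eLpNorm_of_ae_le_mul
      (Eventually.of_forall fun x => norm_truncateAt_sub_le hM _ _) 2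
  refine h1.trans ((mul_le_mul_right
    (eLpNorm_meanFieldPotential_sub_translate_le hf hreal c) _).trans_eq ?_)
  rw [← ENNReal.ofReal_mul (by norm_num)]
  congr 1
  ring

theorem norm_hartree_le (hf : MemLp (rieszSymbol f) 2) {h : Plane → ℂ}
    (hW : MemLp (rieszSymbol h) 2) :
    ‖hartree f h‖ ≤ 4 * Real.pi *
      ((eLpNorm (rieszSymbol f) 2).toReal * (eLpNorm (rieszSymbol h) 2).toReal) := by
  rw [hartree_eq, norm_mul, norm_mul, Complex.norm_real, Real.norm_of_nonneg Real.pi_pos.le,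
    Complex.norm_ofNat]
  have h1 : MemLp (fun ξ => (starRingEnd ℂ) (rieszSymbol f ξ)) 2 := hf.star
  have h2 : eLpNorm (fun ξ => (starRingEnd ℂ) (rieszSymbol f ξ)) 2 = eLpNorm (rieszSymbol f) 2 :=
    eLpNorm_congr_norm_ae (Eventually.of_forall fun ξ => by simp)
  have h3 := norm_integral_mul_le_eLpNorm h1 hW
  rw [h2] at h3
  gcongr

theorem hartree_eq_add (hf : MemLp (rieszSymbol f) 2) {h s : Plane → ℂ} (hh : Integrable h)
    (hs : Integrable s) (hsW : MemLp (rieszSymbol s) 2)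
    (hd : MemLp (rieszSymbol fun x => h x - s x) 2) :
    hartree f h = hartree f (fun x => h x - s x) + hartree f s := by
  have h1 : MemLp (fun ξ => (starRingEnd ℂ) (rieszSymbol f ξ)) 2 := hf.star
  simp only [hartree_eq]
  have i1 : Integrable (fun ξ => (starRingEnd ℂ) (rieszSymbol f ξ) *
    rieszSymbol (fun x => h x - s x) ξ) := h1.integrable_mul hd
  have i2 : Integrable (fun ξ => (starRingEnd ℂ) (rieszSymbol f ξ) * rieszSymbol s ξ) :=
    h1.integrable_mul hsW
  rw [← mul_add, ← integral_add i1 i2]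
  simp only [← mul_add, rieszSymbol_sub hh hs, sub_add_cancel]

theorem hasTruncatedIntegral_meanFieldPotential (hf : f ∈ coulombSpace)
    (hreal : ∀ᵐ x, (f x).im = 0) {h : Plane → ℂ} (hh : Integrable h)
    (hW : MemLp (rieszSymbol h) 2) :
    HasTruncatedIntegral (meanFieldPotential f) h (hartree f h) := by
  have hfW := memLp_rieszSymbol hf
  have hV := (locallyIntegrable_meanFieldPotential f).aestronglyMeasurable
  set A : ℝ := (eLpNorm (rieszSymbol f) 2).toReal with hA
  have hA0 : 0 ≤ A := ENNReal.toReal_nonneg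
  set m : ℝ := ∫ b, gauss b * ‖b‖ ^ 2 with hm
  have hm0 : 0 ≤ m := integral_nonneg fun b => mul_nonneg (gauss_pos b).le (by positivity)
  -- The sum of the continuity constants of the truncated pairing and of `𝒟(f, ·)`; the added 1
  -- ensures positivity.
  set K : ℝ := (2 * (4 * Real.pi * A)) * (2 * Real.pi * m) + 4 * Real.pi * A + 1 with hK
  have hK0 : 0 < K := by positivity
  rw [HasTruncatedIntegral, Metric.tendsto_nhds]
  intro ε hε
  obtain ⟨s, hsW, hdW, hlt⟩ := exists_schwartz_eLpNorm_rieszSymbol_sub_lt hh hW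
    (ε := ε / (2 * K)) (by positivity)
  have hT := hasTruncatedIntegral_of_integrable hV s.continuous.aestronglyMeasurable
    (integrable_meanFieldPotential_mul_schwartz f s)
  rw [integral_meanFieldPotential_mul_schwartz hf hreal s hsW, HasTruncatedIntegral,
    Metric.tendsto_nhds] at hT
  filter_upwards [hT (ε / 2) (by positivity), eventually_gt_atTop 0] with M hM hM0
  rw [dist_eq_norm] at hM ⊢
  have hb : ∀ {k : Plane → ℂ}, Integrable k →
      Integrable (fun x => truncateAt M (meanFieldPotential f x) * k x) := fun hk =>
    hk.bdd_mul ((continuous_truncateAt hM0).comp_aestronglyMeasurable hV)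
      (Eventually.of_forall fun x => norm_truncateAt_le hM0 _)
  have hdi : Integrable (fun x => h x - s x) := hh.sub s.integrable
  have e1 : ∫ x, truncateAt M (meanFieldPotential f x) * h x =
      (∫ x, truncateAt M (meanFieldPotential f x) * (h x - s x)) +
        ∫ x, truncateAt M (meanFieldPotential f x) * s x := by
    rw [← integral_add (hb hdi) (hb s.integrable)]
    simp only [← mul_add, sub_add_cancel]
  have b1 := norm_integral_truncateAt_mul_le hf hreal hM0 hdi hdW
  have b2 := norm_hartree_le hfW hdW
  rw [← hA] at b1 b2
  set d : ℝ := (eLpNorm (rieszSymbol fun x => h x - s x) 2).toReal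
  have hd0 : 0 ≤ d := ENNReal.toReal_nonneg
  rw [e1, hartree_eq_add hfW hh s.integrable hsW hdW]
  have b3 : K * d < ε / 2 := by
    calc K * d < K * (ε / (2 * K)) := by gcongr
      _ = ε / 2 := by field_simp
  have b4 : 2 * (4 * Real.pi * A) * d * (2 * Real.pi * m) + 4 * Real.pi * (A * d) ≤ K * d := by
    rw [hK]
    nlinarith
  calc _ = ‖(∫ x, truncateAt M (meanFieldPotential f x) * (h x - s x)) -
          hartree f (fun x => h x - s x) +
          ((∫ x, truncateAt M (meanFieldPotential f x) * s x) - hartree f s)‖ := by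
        congr 1
        ring
    _ ≤ ‖∫ x, truncateAt M (meanFieldPotential f x) * (h x - s x)‖ +
          ‖hartree f (fun x => h x - s x)‖ +
          ‖(∫ x, truncateAt M (meanFieldPotential f x) * s x) - hartree f s‖ :=
        (norm_add_le _ _).trans (by gcongr; exact norm_sub_le _ _)
    _ < ε := by linarith

theorem fourier_neg_laplacian (φ : 𝓢(Plane, ℂ)) (ξ : Plane) :
    𝓕 (-(Laplacian.laplacian φ) : 𝓢(Plane, ℂ)) ξ = ((2 * Real.pi * ‖ξ‖ : ℝ) : ℂ) ^ 2 * 𝓕 φ ξ := by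
  rw [SchwartzMap.laplacian_eq_fourierMultiplierCLM, SchwartzMap.fourierMultiplierCLM_apply,
    ← neg_smul, neg_neg, FourierTransform.fourier_smul, FourierTransform.fourier_fourierInv_eq]
  have hg : Function.HasTemperateGrowth (fun x : Plane => ‖x‖ ^ 2) := by fun_prop
  change (2 * Real.pi) ^ 2 • (SchwartzMap.smulLeftCLM ℂ (fun x : Plane => ‖x‖ ^ 2) (𝓕 φ)) ξ = _
  rw [SchwartzMap.smulLeftCLM_apply_apply hg, Complex.real_smul, Complex.real_smul]
  push_cast
  ring

/-- The symbol of `-Δφ` is `2π|ξ| 𝓕 φ`, which is square integrable for every Schwartz `φ`. In `𝒟(f,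
-Δφ)` its factor cancels the denominator in the symbol of `f`, and the exchange formula returns `∫ f
φ`. -/
theorem integral_meanFieldPotential_mul_neg_laplacian (hf : f ∈ coulombSpace)
    (hreal : ∀ᵐ x, (f x).im = 0) (φ : 𝓢(Plane, ℂ)) :
    ∫ x, meanFieldPotential f x * (-(Laplacian.laplacian φ) : 𝓢(Plane, ℂ)) x =
      ∫ x, 4 * (Real.pi : ℂ) * f x * φ x := by
  set s : 𝓢(Plane, ℂ) := -(Laplacian.laplacian φ) with hs
  have hsym : ∀ ξ, rieszSymbol s ξ = ((2 * Real.pi * ‖ξ‖ : ℝ) : ℂ) * 𝓕 φ ξ := by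
    intro ξ
    rw [rieszSymbol, ← SchwartzMap.fourier_coe, hs, fourier_neg_laplacian, sq]
    by_cases h : ((2 * Real.pi * ‖ξ‖ : ℝ) : ℂ) = 0
    · simp [h]
    · field_simp
  have hsW : MemLp (rieszSymbol s) 2 := by
    obtain ⟨C, hC⟩ := (𝓕 φ).exists_norm_le_inv_one_add_norm_pow
    have hC0 : 0 ≤ C := by simpa using (norm_nonneg _).trans (hC 0)
    refine memLp_two_inv_one_add_norm_sq.of_le_mul (c := 2 * Real.pi * C)
      (aestronglyMeasurable_rieszSymbol s.integrable) (Eventually.of_forall fun ξ => ?_)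
    rw [hsym, norm_mul, Complex.norm_real, Real.norm_of_nonneg (by positivity),
      Real.norm_of_nonneg (by positivity)]
    have h1 : ‖ξ‖ * ((1 + ‖ξ‖) ^ 6)⁻¹ ≤ ((1 + ‖ξ‖) ^ 2)⁻¹ := by
      rw [← div_eq_mul_inv, inv_eq_one_div, div_le_div_iff₀ (by positivity) (by positivity),
        one_mul]
      have h2 : (1 : ℝ) ≤ 1 + ‖ξ‖ := by linarith [norm_nonneg ξ]
      calc ‖ξ‖ * (1 + ‖ξ‖) ^ 2 ≤ (1 + ‖ξ‖) * (1 + ‖ξ‖) ^ 2 := by gcongr; linarith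
        _ = (1 + ‖ξ‖) ^ 3 := by ring
        _ ≤ _ := pow_le_pow_right₀ h2 (by norm_num)
    calc _ ≤ 2 * Real.pi * ‖ξ‖ * (C * ((1 + ‖ξ‖) ^ 6)⁻¹) := by
          gcongr
          exact hC ξ
      _ = 2 * Real.pi * C * (‖ξ‖ * ((1 + ‖ξ‖) ^ 6)⁻¹) := by ring
      _ ≤ _ := by gcongr
  rw [integral_meanFieldPotential_mul_schwartz hf hreal s hsW, hartree_eq]
  simp only [mul_assoc, integral_const_mul]
  congr 2
  have e1 : ∫ ξ, (starRingEnd ℂ) (rieszSymbol f ξ) * rieszSymbol s ξ =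
      ∫ ξ, 𝓕⁻ f ξ * 𝓕 φ ξ := by
    have hne : ∀ᵐ ξ : Plane, ξ ≠ 0 := by simp [ae_iff, measure_singleton]
    refine integral_congr_ae ?_
    filter_upwards [hne] with ξ hξ
    have h0 : ((2 * Real.pi * ‖ξ‖ : ℝ) : ℂ) ≠ 0 := by
      rw [Complex.ofReal_ne_zero]
      have := norm_pos_iff.2 hξ
      positivity
    rw [← rieszSymbol_neg_of_real hreal, hsym, rieszSymbol, norm_neg,
      Real.fourierInv_eq_fourier_neg]
    field_simp
  rw [e1, integral_fourierInv_mul_swap hf.1 (𝓕 φ).integrable, ← SchwartzMap.fourierInv_coe,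
    FourierTransform.fourierInv_fourier_eq]

theorem isDistribNegLaplacian_meanFieldPotential (hf : f ∈ coulombSpace)
    (hreal : ∀ᵐ x, (f x).im = 0) :
    IsDistribNegLaplacian (meanFieldPotential f) (fun x => 4 * (Real.pi : ℂ) * f x) := by
  refine ⟨locallyIntegrable_meanFieldPotential f, (hf.1.const_mul _).locallyIntegrable, ?_⟩
  intro φ hφ hφc
  have h := integral_meanFieldPotential_mul_neg_laplacian hf hreal (hφc.toSchwartzMap hφ)
  refine Eq.trans ?_ h
  refine integral_congr_ae (Eventually.of_forall fun x => ?_)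
  change _ = meanFieldPotential f x * -(Laplacian.laplacian (hφc.toSchwartzMap hφ) x)
  rw [SchwartzMap.laplacian_apply]
  rfl

end Main

theorem theorem2p4 (f : Plane → ℂ) (hf : f ∈ coulombSpace)
    (hreal : ∀ᵐ x : Plane, (f x).im = 0) :
    -- the integrals that define `V_f` converge absolutely at almost every point
    (∀ᵐ x : Plane,
      IntegrableOn (rieszInnerKernel (coulombW f) x) {y : Plane | ‖y‖ < 1} ∧
      IntegrableOn (rieszOuterKernel (coulombW f) x) {y : Plane | 1 ≤ ‖y‖}) ∧
    -- `𝒟(f, h) = ∫ V_f h` for every `h` in the Coulomb space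
    (∀ h ∈ coulombSpace,
      HasTruncatedIntegral (meanFieldPotential f) h (hartree f h) ∧
      (Integrable (fun x : Plane => meanFieldPotential f x * h x) →
        hartree f h = ∫ x : Plane, meanFieldPotential f x * h x)) ∧
    -- the integral converges absolutely for every Schwartz function
    (∀ h : 𝓢(Plane, ℂ), Integrable (fun x : Plane => meanFieldPotential f x * h x)) ∧
    -- `-Δ V_f = 4π f` in the sense of distributions
    IsDistribNegLaplacian (meanFieldPotential f) (fun x => 4 * (Real.pi : ℂ) * f x) := by
  refine ⟨ae_integrableOn_rieszKernels f, fun h hh => ?_,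
    integrable_meanFieldPotential_mul_schwartz f, isDistribNegLaplacian_meanFieldPotential hf hreal⟩
  have hT := hasTruncatedIntegral_meanFieldPotential hf hreal hh.1 (memLp_rieszSymbol hh)
  exact ⟨hT, fun hi => tendsto_nhds_unique hT (hasTruncatedIntegral_of_integrable
    (locallyIntegrable_meanFieldPotential f).aestronglyMeasurable hh.1.1 hi)⟩
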